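/- Let $K$ be an algebraically closed field, let $Q$ be a finite connected quiver such that at most two arrows start and at most two arrows end at each vertex, and let $\Lambda = KQ/I$, where $I$ is an admissible ideal of the path algebra $KQ$ (that is, $R^m\subseteq I\subseteq R^2$ for some $m\ge 2$, where $R$ is the ideal generated by the arrows). Assume that - $\Lambda$ is tame, i.e. for each $d$ there are finitely many $K[X]$-$\Lambda$-bimodules $M_1,\dots,M_n$, finitely generated and free over $K[X]$ (with $K$ acting centrally), such that all but finitely many isomorphism classes of indecomposable right $\Lambda$-modules of dimension $d$ are of the form $K[X]/(X-\lambda)\otimes_{K[X]}M_k$ with $\lambda\in K$; - $\Lambda$ is symmetric, i.e. it admits a nondegenerate symmetric associative $K$-bilinear form $\Lambda\times\Lambda\to K$; - $\Lambda$ is periodic of period four, i.e. $4$ is the least $d\ge 1$ with $\Omega^d(\Lambda)\cong\Lambda$ as $\Lambda$-$\Lambda$-bimodules, where $\Omega$ denotes the syzygy (the kernel of a projective cover); - $\Lambda$ has infinite representation type, i.e. it does not have only finitely many isomorphism classes of finitely generated indecomposable right modules. Call a vertex an $m$-vertex if exactly $m$ arrows end at it and exactly $m$ arrows start at it. Let $i$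 be a $1$-vertex of $Q$ which is part of a triangle, i.e. there are arrows $\gamma\colon x\to i$, $\alpha\colon i\to j$ and $\beta\colon j\to x$ in $Q$. Then both $x$ and $j$ are $2$-vertices. -/

import Mathlib

open scoped TensorProduct Polynomial

universe w u v

noncomputable section

/-! ### Path algebras and admissible ideals -/

/-- All paths of a quiver, including the trivial path at each vertex. -/
abbrev AllPaths (V : Type u) [Quiver.{v} V] : Type (max u v) :=
  Σ a b : V, Quiver.Path a b

/-- The path algebra `KQ`: the `K`-vector space with basis the set of all paths of the quiver.
Paths are composed from left to right. -/
def PathAlgebra (K : Type w) [Field K] (V : Type u) [Quiver.{v} V] : Type (max u v w) :=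
  AllPaths V →₀ K

namespace PathAlgebra

variable {K : Type w} [Field K] {V : Type u} [Quiver.{v} V]

instance : AddCommGroup (PathAlgebra K V) := inferInstanceAs (AddCommGroup (AllPaths V →₀ K))

instance : Module K (PathAlgebra K V) := inferInstanceAs (Module K (AllPaths V →₀ K))

variable (K V) in
/-- The basis of the path algebra consisting of all paths. -/
def pathBasis : Module.Basis (AllPaths V) K (PathAlgebra K V) :=
  Module.Basis.ofRepr (LinearEquiv.refl K (AllPaths V →₀ K))

/-- The basis element of the path algebra given by a path. -/
def ofPath {a b : V} (p : Quiver.Path a b) : PathAlgebra K V :=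
  pathBasis K V ⟨a, b, p⟩

open Classical in
/-- The product of two paths: their concatenation if the first ends where the second starts,
and zero otherwise. -/
def pathMul (p q : AllPaths V) : PathAlgebra K V :=
  if h : q.1 = p.2.1 then ofPath (p.2.2.comp (q.2.2.cast h rfl)) else 0

/-- The bilinear extension of the product of paths. -/
def mulBilin : PathAlgebra K V →ₗ[K] PathAlgebra K V →ₗ[K] PathAlgebra K V :=
  (pathBasis K V).constr K fun p => (pathBasis K V).constr K fun q => pathMul p q

instance : Mul (PathAlgebra K V) := ⟨fun f g => mulBilin f g⟩

theorem mul_def (f g : PathAlgebra K V) : f * g = mulBilin f g := rfl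

theorem ofPath_mul_ofPath {a b c d : V} (p : Quiver.Path a b) (q : Quiver.Path c d) :
    (ofPath p * ofPath q : PathAlgebra K V) = pathMul ⟨a, b, p⟩ ⟨c, d, q⟩ := by
  simp only [mul_def, mulBilin, ofPath, Module.Basis.constr_basis]

theorem ofPath_mul_comp {a b c : V} (p : Quiver.Path a b) (q : Quiver.Path b c) :
    (ofPath p * ofPath q : PathAlgebra K V) = ofPath (p.comp q) := by
  rw [ofPath_mul_ofPath, pathMul, dif_pos rfl]
  rfl

theorem ofPath_mul_of_ne {a b c d : V} (p : Quiver.Path a b) (q : Quiver.Path c d) (h : c ≠ b) :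
    (ofPath p * ofPath q : PathAlgebra K V) = 0 := by
  rw [ofPath_mul_ofPath, pathMul, dif_neg h]

theorem induction_ofPath {P : PathAlgebra K V → Prop} (f : PathAlgebra K V) (h0 : P 0)
    (hadd : ∀ f g, P f → P g → P (f + g))
    (hsmul : ∀ (c : K) (a b : V) (p : Quiver.Path a b), P (c • ofPath p)) : P f := by
  rw [← (pathBasis K V).linearCombination_repr f, Finsupp.linearCombination_apply]
  exact Finset.sum_induction _ P hadd h0 fun x _ => hsmul _ x.1 x.2.1 x.2.2

theorem add_mul_aux (f g h : PathAlgebra K V) : (f + g) * h = f * h + g * h := by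
  simp [mul_def]

theorem mul_add_aux (f g h : PathAlgebra K V) : f * (g + h) = f * g + f * h := by
  simp [mul_def]

theorem smul_mul_aux (c : K) (f g : PathAlgebra K V) : (c • f) * g = c • (f * g) := by
  simp [mul_def]

theorem mul_smul_aux (c : K) (f g : PathAlgebra K V) : f * (c • g) = c • (f * g) := by
  simp [mul_def]

theorem zero_mul_aux (f : PathAlgebra K V) : 0 * f = 0 := by
  simp [mul_def]

theorem mul_zero_aux (f : PathAlgebra K V) : f * 0 = 0 := by
  simp [mul_def]

theorem mul_assoc_aux (f g h : PathAlgebra K V) : f * g * h = f * (g * h) := by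
  induction f using induction_ofPath with
  | h0 => simp only [zero_mul_aux]
  | hadd f₁ f₂ h₁ h₂ => simp only [add_mul_aux, h₁, h₂]
  | hsmul c a b p =>
  induction g using induction_ofPath with
  | h0 => simp only [zero_mul_aux, mul_zero_aux]
  | hadd f₁ f₂ h₁ h₂ => simp only [add_mul_aux, mul_add_aux, h₁, h₂]
  | hsmul c' a' b' p' =>
  induction h using induction_ofPath with
  | h0 => simp only [mul_zero_aux]
  | hadd f₁ f₂ h₁ h₂ => simp only [mul_add_aux, h₁, h₂]
  | hsmul c'' a'' b'' p'' =>
  simp only [smul_mul_aux, mul_smul_aux]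
  congr 3
  by_cases h₁ : a' = b
  · subst h₁
    by_cases h₂ : a'' = b'
    · subst h₂
      simp only [ofPath_mul_comp, Quiver.Path.comp_assoc]
    · simp only [ofPath_mul_comp, ofPath_mul_of_ne _ _ h₂, mul_zero_aux]
  · by_cases h₂ : a'' = b'
    · subst h₂
      simp only [ofPath_mul_comp, ofPath_mul_of_ne _ _ h₁, zero_mul_aux]
    · simp only [ofPath_mul_of_ne _ _ h₁, ofPath_mul_of_ne _ _ h₂, zero_mul_aux, mul_zero_aux]

section Unital

variable [Fintype V]

/-- The identity is the sum of the trivial paths. -/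
instance : One (PathAlgebra K V) := ⟨∑ a : V, ofPath (Quiver.Path.nil : Quiver.Path a a)⟩

theorem one_def : (1 : PathAlgebra K V) = ∑ a : V, ofPath (Quiver.Path.nil : Quiver.Path a a) :=
  rfl

theorem one_mul_aux (f : PathAlgebra K V) : 1 * f = f := by
  induction f using induction_ofPath with
  | h0 => simp only [mul_zero_aux]
  | hadd f₁ f₂ h₁ h₂ => simp only [mul_add_aux, h₁, h₂]
  | hsmul c a b p =>
    rw [mul_smul_aux, one_def, mul_def, map_sum, LinearMap.sum_apply]
    simp only [← mul_def]
    rw [Finset.sum_eq_single a, ofPath_mul_comp, Quiver.Path.nil_comp]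
    · intro d _ hd
      exact ofPath_mul_of_ne _ _ hd.symm
    · simp

theorem mul_one_aux (f : PathAlgebra K V) : f * 1 = f := by
  induction f using induction_ofPath with
  | h0 => simp only [zero_mul_aux]
  | hadd f₁ f₂ h₁ h₂ => simp only [add_mul_aux, h₁, h₂]
  | hsmul c a b p =>
    rw [smul_mul_aux, one_def, mul_def, map_sum]
    simp only [← mul_def]
    rw [Finset.sum_eq_single b, ofPath_mul_comp, Quiver.Path.comp_nil]
    · intro d _ hd
      exact ofPath_mul_of_ne _ _ hd
    · simp

instance : Ring (PathAlgebra K V) :=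
  { (inferInstance : AddCommGroup (PathAlgebra K V)),
    (inferInstance : Mul (PathAlgebra K V)),
    (inferInstance : One (PathAlgebra K V)) with
    left_distrib := mul_add_aux
    right_distrib := add_mul_aux
    zero_mul := zero_mul_aux
    mul_zero := mul_zero_aux
    mul_assoc := mul_assoc_aux
    one_mul := one_mul_aux
    mul_one := mul_one_aux }

instance : Algebra K (PathAlgebra K V) :=
  Algebra.ofModule smul_mul_aux mul_smul_aux

end Unital

variable (K V) in
/-- The arrow ideal `R` of the path algebra, spanned by all paths of length at least one. -/
def arrowIdeal : Submodule K (PathAlgebra K V) :=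
  Submodule.span K {f | ∃ (a b : V) (p : Quiver.Path a b), 1 ≤ p.length ∧ f = ofPath p}

/-- A two-sided ideal `I` of the path algebra is admissible if `R ^ m ⊆ I ⊆ R ^ 2` for some
`m ≥ 2`, where `R` is the arrow ideal. -/
def IsAdmissible [Fintype V] (I : Ideal (PathAlgebra K V)) [I.IsTwoSided] : Prop :=
  I.restrictScalars K ≤ arrowIdeal K V ^ 2 ∧
    ∃ m : ℕ, 2 ≤ m ∧ arrowIdeal K V ^ m ≤ I.restrictScalars K

end PathAlgebra

/-! ### Vertices of a quiver -/

/-- `i` is an `m`-vertex (`m`-regular): exactly `m` arrows end at `i` and exactly `m` arrows start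
at `i`. -/
def IsRegularVertex {V : Type u} [Quiver.{v} V] (m : ℕ) (i : V) : Prop :=
  Nat.card (Quiver.Costar i) = m ∧ Nat.card (Quiver.Star i) = m

/-- A (finite) quiver is biserial if at most two arrows end and at most two arrows start at each
vertex. -/
def IsBiserialQuiver (V : Type u) [Quiver.{v} V] : Prop :=
  ∀ i : V, Nat.card (Quiver.Costar i) ≤ 2 ∧ Nat.card (Quiver.Star i) ≤ 2

/-- A quiver is connected if its underlying undirected graph is. -/
def IsConnectedQuiver (V : Type u) [Quiver.{v} V] : Prop :=
  Nonempty V ∧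
    ∀ a b : V, Quiver.WeaklyConnectedComponent.mk a = Quiver.WeaklyConnectedComponent.mk b

/-! ### Representation type

Right modules over `A` are modules over `Aᵐᵒᵖ`. -/

/-- A nonzero module that is not the direct sum of two nonzero submodules. -/
def IsIndecomposableModule (R : Type u) [Ring R] (M : Type v) [AddCommGroup M] [Module R M] : Prop :=
  Nontrivial M ∧ ∀ N N' : Submodule R M, IsCompl N N' → N = ⊥ ∨ N' = ⊥

/-- Finite representation type: up to isomorphism there are only finitely many finitely generated
indecomposable right modules. -/
def IsFiniteRepType (A : Type u) [Ring A] : Prop :=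
  ∃ (n : ℕ) (E : Fin n → ModuleCat.{u} Aᵐᵒᵖ), ∀ N : ModuleCat.{u} Aᵐᵒᵖ,
    Module.Finite Aᵐᵒᵖ N → IsIndecomposableModule Aᵐᵒᵖ N → ∃ k, Nonempty (N ≃ₗ[Aᵐᵒᵖ] E k)

/-- A `K[X]`-`A`-bimodule on which `K` acts centrally, finitely generated and free as a left
`K[X]`-module. -/
structure FreePolyBimodule (K : Type w) [Field K] (A : Type u) [Ring A] [Algebra K A] where
  carrier : Type u
  [addCommGroup : AddCommGroup carrier]
  [polyModule : Module K[X] carrier]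
  [rightModule : Module Aᵐᵒᵖ carrier]
  [smulCommClass : SMulCommClass K[X] Aᵐᵒᵖ carrier]
  central : ∀ (c : K) (m : carrier),
    (Polynomial.C c : K[X]) • m = (algebraMap K Aᵐᵒᵖ c) • m
  free : Module.Free K[X] carrier
  finite : Module.Finite K[X] carrier

attribute [instance] FreePolyBimodule.addCommGroup FreePolyBimodule.polyModule
  FreePolyBimodule.rightModule FreePolyBimodule.smulCommClass

/-- The specialization of a bimodule `M` at `c`: the right `A`-module
`M ⊗ K[X] / (X - c)`, tensored over `K[X]`. -/
abbrev FreePolyBimodule.specialize {K : Type w} [Field K] {A : Type u} [Ring A] [Algebra K A]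
    (M : FreePolyBimodule K A) (c : K) : Type (max u w) :=
  M.carrier ⊗[K[X]] (K[X] ⧸ Ideal.span {(Polynomial.X - Polynomial.C c : K[X])})

/-- Tameness of a finite-dimensional algebra: in every dimension `d`, all but finitely many
isomorphism classes of indecomposable right `A`-modules of dimension `d` are specializations of
finitely many `K[X]`-`A`-bimodules that are finitely generated free over `K[X]`. -/
def IsTameAlgebra (K : Type w) [Field K] (A : Type u) [Ring A] [Algebra K A] : Prop :=
  ∀ d : ℕ, ∃ (n : ℕ) (M : Fin n → FreePolyBimodule K A) (m : ℕ) (E : Fin m → ModuleCat.{u} Aᵐᵒᵖ),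
    ∀ (N : Type u) [AddCommGroup N] [Module K N] [Module Aᵐᵒᵖ N] [IsScalarTower K Aᵐᵒᵖ N],
      Module.Finite K N → Module.finrank K N = d → IsIndecomposableModule Aᵐᵒᵖ N →
        (∃ k, Nonempty (N ≃ₗ[Aᵐᵒᵖ] E k)) ∨
          ∃ (k : Fin n) (c : K), Nonempty (N ≃ₗ[Aᵐᵒᵖ] (M k).specialize c)

/-! ### Symmetric algebras -/

/-- A symmetric algebra: there is a nondegenerate symmetric associative `K`-bilinear form. -/
def IsSymmetricKAlgebra (K : Type w) [Field K] (A : Type u) [Ring A] [Algebra K A] : Prop :=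
  ∃ B : A →ₗ[K] A →ₗ[K] K, (∀ a b, B a b = B b a) ∧ (∀ a b c, B (a * b) c = B a (b * c)) ∧
    ∀ a, (∀ b, B a b = 0) → a = 0

/-! ### Syzygies and periodic algebras -/

/-- A projective cover: a surjection from a projective module with superfluous kernel. -/
def IsProjectiveCover {R : Type u} [Ring R] {P M : ModuleCat.{v} R} (π : P →ₗ[R] M) : Prop :=
  Module.Projective R P ∧ Function.Surjective π ∧
    ∀ N : Submodule R P, N ⊔ LinearMap.ker π = ⊤ → N = ⊤

/-- `N` is isomorphic to the syzygy of `M`, the kernel of a projective cover of `M`. -/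
def IsSyzygy {R : Type u} [Ring R] (M N : ModuleCat.{v} R) : Prop :=
  ∃ (P : ModuleCat.{v} R) (π : P →ₗ[R] M), IsProjectiveCover π ∧
    Nonempty (N ≃ₗ[R] LinearMap.ker π)

/-- `N` is isomorphic to the `n`-th syzygy of `M`. -/
def IsNthSyzygy {R : Type u} [Ring R] : ℕ → ModuleCat.{v} R → ModuleCat.{v} R → Prop
  | 0, M, N => Nonempty (N ≃ₗ[R] M)
  | n + 1, M, N => ∃ L : ModuleCat.{v} R, IsSyzygy M L ∧ IsNthSyzygy n L N

/-- `M` is a periodic module of period `d`: `d` is the least positive integer for which the `d`-th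
syzygy of `M` is isomorphic to `M`. -/
def IsPeriodicModule {R : Type u} [Ring R] (d : ℕ) (M : ModuleCat.{v} R) : Prop :=
  IsLeast {n : ℕ | 1 ≤ n ∧ IsNthSyzygy n M M} d

/-- `A` as an `A`-`A`-bimodule, that is, as a module over its enveloping algebra `A ⊗[K] Aᵐᵒᵖ`,
where `a ⊗ b` acts by `x ↦ a * x * b`. -/
def regularBimodule (K : Type w) [Field K] (A : Type u) [Ring A] [Algebra K A] :
    ModuleCat.{u} (A ⊗[K] Aᵐᵒᵖ) :=
  letI : Module (A ⊗[K] Aᵐᵒᵖ) A := instModuleTensorProductMop K A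
  ModuleCat.of (A ⊗[K] Aᵐᵒᵖ) A

/-- `A` is a periodic algebra of period `d`: it is periodic of period `d` as a bimodule. -/
def IsPeriodicAlgebra (K : Type w) [Field K] (A : Type u) [Ring A] [Algebra K A] (d : ℕ) : Prop :=
  IsPeriodicModule d (regularBimodule K A)

/-- Tame symmetric algebras of period four. -/
structure IsTSP4 (K : Type w) [Field K] (A : Type u) [Ring A] [Algebra K A] : Prop where
  tame : IsTameAlgebra K A
  symmetric : IsSymmetricKAlgebra K A
  periodic : IsPeriodicAlgebra K A 4

end

set_option linter.unusedSectionVars false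

/-! ### Algebras with split orthogonal idempotents -/

/-! Write Λ = KQ/I, let n a b be the number of arrows from a to b, let P_c = Λe_c with simple top
S_c, and let p c d = dim e_d Λ e_c. The theorem follows from two numerical relations between n and
p.

Tensoring a minimal bimodule resolution of Λ on the right with S_a gives a minimal projective
resolution of S_a: every bimodule syzygy is projective as a right module, so exactness survives.
Period four closes it up to an exact sequence 0 → S_a → P_a → X₂ → X₁ → P_a → S_a → 0. Since X₁
covers rad P_a, it is the sum of P_c over the arrows c → a. Since Λ is symmetric, P_c has socle S_c;
the socle of X₂ is that of P_a/S_a, so X₂ is the sum of P_c over the arrows a → c. Counting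
dimensions at d gives ∑ n c a · p c d = ∑ n a c · p c d. Moreover the second syzygy of S_a has the
same top as X₂, so its dimension at d is at least n a d, which gives p a d + n a d ≤ ∑ n c a · p c d
+ δ_ad. This is `cartan_of_isPeriodicAlgebra`.

Tops and socles are measured by linear algebra: `coeigen X c` is dual to the S_c-part of the top,
`eigen X c` is the S_c-part of the socle, and `radForms c a` is dual to e_c(rad/rad²)e_a. For an
admissible ideal the last has dimension n c a (`finrank_radForms`).

A loop at i would be the whole quiver, and Λ would be a truncated polynomial ring, of finite type
(`isFiniteRepType_of_loop`); so x ≠ i ≠ j. The equality at i then reads p x d = p j d, and the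
inequality at (i, j) gives p i j < p x j. If only one arrow started, or only one ended, at x or j,
these relations would be contradictory (`two_le_degree_of_triangle`). Biseriality bounds the degrees
by two from above. -/

/-- A complete system of orthogonal idempotents `e i` of a `K`-algebra together with characters
`χ i` dual to it. -/
structure SplitIdempotents (K R ι : Type*) [Field K] [Ring R] [Algebra K R] [Fintype ι]
    [DecidableEq ι] where
  e : ι → R
  χ : ι → R →ₐ[K] K
  χ_e : ∀ i j, χ i (e j) = if i = j then 1 else 0
  e_mul_e : ∀ i j, e i * e j = if i = j then e i else 0
  sum_e : ∑ i, e i = 1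

namespace SplitIdempotents

variable {K R ι : Type*} [Field K] [Ring R] [Algebra K R] [Fintype ι] [DecidableEq ι]
variable (S : SplitIdempotents K R ι)

/-- The intersection of the kernels of the characters. -/
def rad : Ideal R := ⨅ i, RingHom.ker (S.χ i)

theorem mem_rad {r : R} : r ∈ S.rad ↔ ∀ i, S.χ i r = 0 := by
  simp [rad, Submodule.mem_iInf, RingHom.mem_ker]

theorem mul_mem_rad_right {r : R} (hr : r ∈ S.rad) (s : R) : r * s ∈ S.rad := by
  rw [mem_rad] at *
  intro i
  simp [hr i]

theorem χ_e_self (i : ι) : S.χ i (S.e i) = 1 := by simp [S.χ_e]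

theorem e_mul_self (i : ι) : S.e i * S.e i = S.e i := by simp [S.e_mul_e]

/-- The component of `r` in `rad` along the span of the idempotents. -/
def radPart : R →ₗ[K] R :=
  LinearMap.id - ∑ i, (S.χ i).toLinearMap.smulRight (S.e i)

theorem radPart_apply (r : R) : S.radPart r = r - ∑ i, S.χ i r • S.e i := by
  simp [radPart, LinearMap.sum_apply]

theorem radPart_mem (r : R) : S.radPart r ∈ S.rad := by
  rw [mem_rad, radPart_apply]
  intro i
  simp [map_sum, S.χ_e]

theorem radPart_of_mem {r : R} (hr : r ∈ S.rad) : S.radPart r = r := by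
  rw [mem_rad] at hr
  simp [radPart_apply, hr]

theorem eq_sum_add_radPart (r : R) : r = ∑ i, S.χ i r • S.e i + S.radPart r := by
  simp [radPart_apply]

theorem e_mul_eq (i : ι) (r : R) : S.e i * r = S.χ i r • S.e i + S.e i * S.radPart r := by
  conv_lhs => rw [S.eq_sum_add_radPart r, mul_add, Finset.mul_sum]
  simp [S.e_mul_e]

section Modules

variable (X : Type*) [AddCommGroup X] [Module K X] [Module R X] [IsScalarTower K R X]
variable (Y : Type*) [AddCommGroup Y] [Module K Y] [Module R Y] [IsScalarTower K R Y]

/-- The weight space of the idempotent `e c`. -/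
def wt (c : ι) : Submodule K X where
  carrier := {x | S.e c • x = x}
  add_mem' := by
    intro x y hx hy
    simp only [Set.mem_ofPred_eq] at *
    rw [smul_add, hx, hy]
  zero_mem' := by simp
  smul_mem' := by
    intro k x hx
    simp only [Set.mem_ofPred_eq] at *
    rw [← algebraMap_smul R k x, smul_smul, ← Algebra.commutes, ← smul_smul, hx]

theorem mem_wt {c : ι} {x : X} : x ∈ S.wt X c ↔ S.e c • x = x := Iff.rfl

/-- The vectors on which the algebra acts through the character `χ c`. -/
def eigen (c : ι) : Submodule K X where
  carrier := {x | ∀ r : R, r • x = S.χ c r • x}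
  add_mem' := by
    intro x y hx hy r
    rw [smul_add, hx r, hy r, smul_add]
  zero_mem' := by simp
  smul_mem' := by
    intro k x hx r
    rw [← algebraMap_smul R k x, smul_smul, ← Algebra.commutes, ← smul_smul, hx r,
      algebraMap_smul, algebraMap_smul, smul_smul, smul_smul, mul_comm]

theorem mem_eigen {c : ι} {x : X} : x ∈ S.eigen X c ↔ ∀ r : R, r • x = S.χ c r • x := Iff.rfl

/-- The functionals that transform by the character `χ c`. -/
def coeigen (c : ι) : Submodule K (X →ₗ[K] K) where
  carrier := {φ | ∀ (r : R) (x : X), φ (r • x) = S.χ c r * φ x}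
  add_mem' := by
    intro φ ψ hφ hψ r x
    simp only [LinearMap.add_apply]
    rw [hφ, hψ, mul_add]
  zero_mem' := by simp
  smul_mem' := by
    intro k φ hφ r x
    simp only [LinearMap.smul_apply, smul_eq_mul]
    rw [hφ]
    ring

theorem mem_coeigen {c : ι} {φ : X →ₗ[K] K} :
    φ ∈ S.coeigen X c ↔ ∀ (r : R) (x : X), φ (r • x) = S.χ c r * φ x := Iff.rfl

instance (c : ι) : Module.Free K (S.coeigen X c) :=
  Module.Free.of_divisionRing K (S.coeigen X c)

variable {X Y}

theorem e_smul_mem_wt (c : ι) (x : X) : S.e c • x ∈ S.wt X c := by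
  rw [mem_wt, smul_smul, e_mul_self]

/-- A linear map induces a map on weight spaces. -/
def wtMap (f : X →ₗ[R] Y) (c : ι) : S.wt X c →ₗ[K] S.wt Y c :=
  (f.restrictScalars K).restrict fun x hx => by
    rw [mem_wt] at *
    simp [← map_smul, hx]

theorem finrank_wt_congr (f : X ≃ₗ[R] Y) (c : ι) :
    Module.finrank K (S.wt X c) = Module.finrank K (S.wt Y c) := by
  refine LinearEquiv.finrank_eq ((f.restrictScalars K).submoduleMap (S.wt X c) |>.trans
    (LinearEquiv.ofEq _ _ ?_))
  ext y
  constructor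
  · rintro ⟨x, hx, rfl⟩
    simp only [SetLike.mem_coe, mem_wt] at *
    simp [← map_smul, hx]
  · intro hy
    refine ⟨f.symm y, ?_, by simp⟩
    simp only [SetLike.mem_coe, mem_wt] at *
    rw [← map_smul, hy]

theorem finrank_eigen_congr (f : X ≃ₗ[R] Y) (c : ι) :
    Module.finrank K (S.eigen X c) = Module.finrank K (S.eigen Y c) := by
  refine LinearEquiv.finrank_eq ((f.restrictScalars K).submoduleMap (S.eigen X c) |>.trans
    (LinearEquiv.ofEq _ _ ?_))
  ext y
  constructor
  · rintro ⟨x, hx, rfl⟩ r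
    simp only [SetLike.mem_coe, mem_eigen] at *
    change r • f x = S.χ c r • (f.restrictScalars K) x
    rw [← map_smul, hx, ← map_smul]
    rfl
  · intro hy
    refine ⟨f.symm y, ?_, by simp⟩
    simp only [SetLike.mem_coe, mem_eigen] at *
    intro r
    rw [← map_smul, hy]
    exact (f.symm.restrictScalars K).map_smul _ _

theorem finrank_coeigen_congr (f : X ≃ₗ[R] Y) (c : ι) :
    Module.finrank K (S.coeigen X c) = Module.finrank K (S.coeigen Y c) := by
  refine LinearEquiv.finrank_eq ((f.symm.restrictScalars K).dualMap.submoduleMap (S.coeigen X c)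
    |>.trans (LinearEquiv.ofEq _ _ ?_))
  ext y
  constructor
  · rintro ⟨x, hx, rfl⟩ r
    simp only [SetLike.mem_coe, mem_coeigen] at *
    simp [hx]
  · intro hy
    refine ⟨(f.restrictScalars K).dualMap y, ?_, by ext; simp⟩
    simp only [SetLike.mem_coe, mem_coeigen] at *
    intro r
    simp [hy]

theorem coeigen_rad {c : ι} {φ : X →ₗ[K] K} (hφ : φ ∈ S.coeigen X c) {x : X}
    (hx : x ∈ (S.rad • ⊤ : Submodule R X)) : φ x = 0 := by
  induction hx using Submodule.smul_induction_on' with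
  | smul r hr n _ => rw [hφ r n, (S.mem_rad.1 hr) c, zero_mul]
  | add x _ y _ hx hy => rw [map_add, hx, hy, add_zero]

/-- Such a functional satisfies φ (e c • x) = φ x, so its restriction to the weight space determines
it. -/
theorem finrank_coeigen_le_wt [FiniteDimensional K X] (c : ι) :
    Module.finrank K (S.coeigen X c) ≤ Module.finrank K (S.wt X c) := by
  rw [← Subspace.dual_finrank_eq (V := S.wt X c)]
  refine LinearMap.finrank_le_finrank_of_injective
    (f := (S.wt X c).subtype.dualMap ∘ₗ (S.coeigen X c).subtype)
    ((injective_iff_map_eq_zero _).2 ?_)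
  rintro ⟨φ, hφ⟩ h
  ext x
  have h1 := hφ (S.e c) x
  rw [S.χ_e_self, one_mul] at h1
  have h2 := LinearMap.congr_fun h ⟨S.e c • x, S.e_smul_mem_wt c x⟩
  simpa [h1] using h2

end Modules

end SplitIdempotents

/-! ### Structure of projective modules -/

namespace SplitIdempotents

variable {K R ι : Type*} [Field K] [Ring R] [Algebra K R] [Fintype ι] [DecidableEq ι]
variable (S : SplitIdempotents K R ι)

theorem mem_span_e {i : ι} {r : R} : r ∈ Ideal.span {S.e i} ↔ r * S.e i = r := by
  rw [Ideal.mem_span_singleton']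
  constructor
  · rintro ⟨a, rfl⟩
    rw [mul_assoc, e_mul_self]
  · intro h
    exact ⟨r, h⟩

theorem χ_of_mem_span_e {i j : ι} {r : R} (hr : r ∈ Ideal.span {S.e i}) (hij : j ≠ i) :
    S.χ j r = 0 := by
  rw [mem_span_e] at hr
  rw [← hr, map_mul, S.χ_e, if_neg hij, mul_zero]

/-- The generator of the left ideal `R e i`. -/
def gen (i : ι) : Ideal.span {S.e i} := ⟨S.e i, Ideal.mem_span_singleton_self _⟩

theorem smul_gen {i : ι} (r : Ideal.span {S.e i}) : (r : R) • S.gen i = r := by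
  ext
  exact S.mem_span_e.1 r.2

section Structure

variable {X : Type*} [AddCommGroup X] [Module R X]

/-- Nakayama's lemma for `X ⧸ N`. -/
theorem eq_top_of_sup_rad_smul_eq_top (hJ : S.rad ≤ Ring.jacobson R) [Module.Finite R X]
    {N : Submodule R X} (h : N ⊔ S.rad • ⊤ = ⊤) : N = ⊤ := by
  by_contra hN
  have : Nontrivial (X ⧸ N) := Submodule.Quotient.nontrivial_iff.2 hN
  have h1 := Submodule.jacobson_smul_lt_top (R := R) (M := X ⧸ N) ⊤
  refine h1.ne (top_le_iff.1 ?_)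
  have h2 := congrArg (Submodule.map N.mkQ) h
  rw [Submodule.map_sup, Submodule.map_smul'', Submodule.map_top, Submodule.range_mkQ,
    Submodule.mkQ_map_self, bot_sup_eq] at h2
  exact h2.ge.trans (Submodule.smul_mono_left hJ)

/-- A finite family of weight vectors that generates `X`. -/
def IsWeightGenerating {m : ℕ} (b : Fin m → ι) (x : Fin m → X) : Prop :=
  (∀ k, S.e (b k) • x k = x k) ∧ Submodule.span R (Set.range x) = ⊤

theorem exists_isWeightGenerating [Module.Finite R X] :
    ∃ (m : ℕ) (b : Fin m → ι) (x : Fin m → X), S.IsWeightGenerating b x := by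
  obtain ⟨n, s, hs⟩ := Module.Finite.exists_fin (R := R) (M := X)
  let f := Fintype.equivFin (Fin n × ι)
  refine ⟨_, fun k => (f.symm k).2, fun k => S.e (f.symm k).2 • s (f.symm k).1, fun k => ?_, ?_⟩
  · rw [smul_smul, e_mul_self]
  · rw [eq_top_iff, ← hs, Submodule.span_le]
    rintro _ ⟨k, rfl⟩
    rw [SetLike.mem_coe, ← one_smul R (s k), ← S.sum_e, Finset.sum_smul]
    refine Submodule.sum_mem _ fun i _ => Submodule.subset_span ⟨f (k, i), by simp⟩

/-- The map from a sum of modules `R e i` given by weight vectors. -/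
def weightMap {m : ℕ} (b : Fin m → ι) (x : Fin m → X) :
    ((k : Fin m) → Ideal.span {S.e (b k)}) →ₗ[R] X :=
  ∑ k, LinearMap.toSpanSingleton R X (x k) ∘ₗ Submodule.subtype _ ∘ₗ LinearMap.proj k

theorem weightMap_apply {m : ℕ} (b : Fin m → ι) (x : Fin m → X)
    (r : (k : Fin m) → Ideal.span {S.e (b k)}) : S.weightMap b x r = ∑ k, (r k : R) • x k := by
  simp [weightMap, LinearMap.sum_apply]

theorem pi_eq_sum_smul_gen {m : ℕ} (b : Fin m → ι) (r : (k : Fin m) → Ideal.span {S.e (b k)}) :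
    r = ∑ k, (r k : R) • Pi.single k (S.gen (b k)) := by
  conv_lhs => rw [← Finset.univ_sum_single r]
  refine Finset.sum_congr rfl fun k _ => ?_
  rw [← Pi.single_smul, S.smul_gen]

theorem weightMap_surjective {m : ℕ} {b : Fin m → ι} {x : Fin m → X}
    (h : S.IsWeightGenerating b x) : Function.Surjective (S.weightMap b x) := by
  rw [← LinearMap.range_eq_top, eq_top_iff, ← h.2, Submodule.span_le]
  rintro _ ⟨k, rfl⟩
  refine ⟨Pi.single k (S.gen (b k)), ?_⟩
  rw [weightMap_apply, Finset.sum_eq_single k]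
  · simpa [gen] using h.1 k
  · intro l _ hl
    simp [Pi.single_eq_of_ne hl]
  · simp

/-- A coefficient outside `rad` is invertible modulo `rad`, so the relation would express its
generator through the others modulo `rad • ⊤`. By Nakayama that generator is superfluous, against
the minimality of `m + 1`. -/
theorem rad_of_mem_ker_weightMap (hJ : S.rad ≤ Ring.jacobson R) [Module.Finite R X] {m : ℕ}
    {b : Fin (m + 1) → ι} {x : Fin (m + 1) → X} (h : S.IsWeightGenerating b x)
    (hmin : ∀ (b' : Fin m → ι) (x' : Fin m → X), ¬ S.IsWeightGenerating b' x')
    {r : (k : Fin (m + 1)) → Ideal.span {S.e (b k)}} (hr : S.weightMap b x r = 0)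
    (k : Fin (m + 1)) : (r k : R) ∈ S.rad := by
  rw [mem_rad]
  intro j
  by_cases hj : j = b k
  swap
  · exact S.χ_of_mem_span_e (r k).2 hj
  subst hj
  by_contra hχ
  refine hmin (b ∘ k.succAbove) (x ∘ k.succAbove) ⟨fun l => h.1 _, ?_⟩
  refine S.eq_top_of_sup_rad_smul_eq_top hJ ?_
  set N := Submodule.span R (Set.range (x ∘ k.succAbove))
  have hl : ∀ l, x (k.succAbove l) ∈ N := fun l => Submodule.subset_span ⟨l, rfl⟩
  suffices hx : Set.range x ⊆ (N ⊔ S.rad • ⊤ : Submodule R X) by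
    rw [eq_top_iff, ← Submodule.span_le, h.2] at *
    exact hx
  rintro _ ⟨l, rfl⟩
  by_cases hlk : l = k
  swap
  · obtain ⟨l', rfl⟩ := Fin.exists_succAbove_eq hlk
    exact Submodule.mem_sup_left (hl l')
  subst hlk
  rw [weightMap_apply, Fin.sum_univ_succAbove _ l] at hr
  have h1 : (r l : R) • x l ∈ N := by
    rw [eq_neg_of_add_eq_zero_left hr]
    exact neg_mem (Submodule.sum_mem _ fun t _ => Submodule.smul_mem _ _ (hl t))
  have h2 : (r l : R) • x l =
      algebraMap K R (S.χ (b l) (r l)) • x l + S.radPart (r l) • x l := by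
    conv_lhs => rw [S.eq_sum_add_radPart (r l), add_smul]
    congr 1
    rw [Finset.sum_eq_single (b l)]
    · rw [Algebra.smul_def, mul_smul, h.1]
    · intro j _ hj
      rw [S.χ_of_mem_span_e (r l).2 hj, zero_smul]
    · simp
  have h3 : x l = algebraMap K R (S.χ (b l) (r l))⁻¹ •
      ((r l : R) • x l - S.radPart (r l) • x l) := by
    rw [h2, add_sub_cancel_right, smul_smul, ← map_mul, inv_mul_cancel₀ hχ, map_one, one_smul]
  rw [SetLike.mem_coe, h3]
  refine Submodule.smul_mem _ _ (Submodule.sub_mem _ (Submodule.mem_sup_left h1)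
    (Submodule.mem_sup_right (Submodule.smul_mem_smul (S.radPart_mem _) Submodule.mem_top)))

/-- A smallest weight generating family gives a surjection whose kernel lies in the radical.
Projectivity makes this kernel a direct summand, hence contained in `rad` times itself, and Nakayama
kills it. -/
theorem exists_equiv_pi (hJ : S.rad ≤ Ring.jacobson R) [Module.Finite R X]
    [Module.Projective R X] :
    ∃ (m : ℕ) (b : Fin m → ι), Nonempty (((k : Fin m) → Ideal.span {S.e (b k)}) ≃ₗ[R] X) := by
  classical
  have hex := S.exists_isWeightGenerating (X := X)
  obtain ⟨b, x, hbx⟩ := Nat.find_spec hex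
  have hmin := fun n => Nat.find_min hex (m := n)
  generalize Nat.find hex = m at *
  refine ⟨m, b, ⟨LinearEquiv.ofBijective (S.weightMap b x) ⟨?_, S.weightMap_surjective hbx⟩⟩⟩
  have hker : ∀ r, S.weightMap b x r = 0 → ∀ k, (r k : R) ∈ S.rad := by
    intro r hr k
    cases m with
    | zero => exact k.elim0
    | succ m =>
      refine S.rad_of_mem_ker_weightMap hJ hbx ?_ hr k
      intro b' x' h'
      exact hmin m (Nat.lt_succ_self m) ⟨b', x', h'⟩
  obtain ⟨σ, hσ⟩ := Module.projective_lifting_property (S.weightMap b x) LinearMap.id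
    (S.weightMap_surjective hbx)
  have hσ' : ∀ y, S.weightMap b x (σ y) = y := fun y => LinearMap.congr_fun hσ y
  set F := S.weightMap b x
  -- The projection onto the kernel of `F` along the image of its section.
  let ρ := LinearMap.id - σ ∘ₗ F
  have hρ : LinearMap.range ρ = LinearMap.ker F := by
    ext r
    constructor
    · rintro ⟨s, rfl⟩
      simp [ρ, hσ']
    · intro hr
      refine ⟨r, ?_⟩
      simp [ρ, LinearMap.mem_ker.1 hr]
  have hfin : (LinearMap.ker F).FG := by
    rw [← hρ, LinearMap.range_eq_map]
    exact Submodule.FG.map _ Module.Finite.fg_top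
  rw [← LinearMap.ker_eq_bot]
  refine hfin.eq_bot_of_le_jacobson_smul ?_
  refine le_trans ?_ (Submodule.smul_mono_left hJ)
  conv_rhs => rw [← hρ, LinearMap.range_eq_map, ← Submodule.map_smul'']
  intro r hr
  refine ⟨r, ?_, by simp [ρ, LinearMap.mem_ker.1 hr]⟩
  rw [SetLike.mem_coe, S.pi_eq_sum_smul_gen b r]
  exact Submodule.sum_mem _ fun k _ => Submodule.smul_mem_smul (hker r hr k) Submodule.mem_top

end Structure

/-! ### Weights, socles and tops of direct sums; the top of R e_b. -/

section Multiplicities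

variable {κ : Type*} [Fintype κ] [DecidableEq κ] (X : κ → Type*) [∀ k, AddCommGroup (X k)]
  [∀ k, Module K (X k)] [∀ k, Module R (X k)] [∀ k, IsScalarTower K R (X k)]
  [∀ k, FiniteDimensional K (X k)]

theorem finrank_wt_pi (c : ι) : Module.finrank K (S.wt ((k : κ) → X k) c) =
    ∑ k, Module.finrank K (S.wt (X k) c) := by
  rw [← Module.finrank_pi_fintype K]
  refine LinearEquiv.finrank_eq
    { toFun := fun x k => ⟨x.1 k, congrFun x.2 k⟩
      invFun := fun x => ⟨fun k => (x k).1, funext fun k => (x k).2⟩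
      map_add' := fun _ _ => rfl
      map_smul' := fun _ _ => rfl
      left_inv := fun _ => rfl
      right_inv := fun _ => rfl }

theorem finrank_eigen_pi (c : ι) : Module.finrank K (S.eigen ((k : κ) → X k) c) =
    ∑ k, Module.finrank K (S.eigen (X k) c) := by
  rw [← Module.finrank_pi_fintype K]
  refine LinearEquiv.finrank_eq
    { toFun := fun x k => ⟨x.1 k, fun r => congrFun (x.2 r) k⟩
      invFun := fun x => ⟨fun k => (x k).1, fun r => funext fun k => (x k).2 r⟩
      map_add' := fun _ _ => rfl
      map_smul' := fun _ _ => rfl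
      left_inv := fun _ => rfl
      right_inv := fun _ => rfl }

theorem finrank_coeigen_pi (c : ι) : Module.finrank K (S.coeigen ((k : κ) → X k) c) =
    ∑ k, Module.finrank K (S.coeigen (X k) c) := by
  rw [← Module.finrank_pi_fintype K]
  refine LinearEquiv.finrank_eq
    { toFun := fun φ k => ⟨φ.1 ∘ₗ LinearMap.single K X k, fun r x => by
        simp only [LinearMap.comp_apply, LinearMap.single_apply]
        rw [← φ.2 r, ← Pi.single_smul]⟩
      invFun := fun φ => ⟨∑ k, (φ k).1 ∘ₗ LinearMap.proj k, fun r x => by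
        simp only [LinearMap.sum_apply, LinearMap.comp_apply, LinearMap.proj_apply, Finset.mul_sum,
          Pi.smul_apply]
        exact Finset.sum_congr rfl fun k _ => (φ k).2 r _⟩
      map_add' := fun _ _ => rfl
      map_smul' := fun _ _ => rfl
      left_inv := fun φ => by
        ext x
        simp only [LinearMap.coe_comp, Function.comp_apply, LinearMap.sum_apply,
          LinearMap.single_apply, LinearMap.proj_apply]
        rw [← map_sum, Finset.univ_sum_single]
      right_inv := fun φ => by
        ext k x
        simp only [LinearMap.coe_comp, Function.comp_apply, LinearMap.sum_apply,
          LinearMap.single_apply, LinearMap.proj_apply]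
        rw [Finset.sum_eq_single k]
        · simp
        · intro l _ hl
          simp [Pi.single_eq_of_ne hl]
        · simp }

/-- The value at the generator determines the functional, and it can be nonzero only for the
character at `b`. -/
theorem finrank_coeigen_span_e [FiniteDimensional K R] (b c : ι) :
    Module.finrank K (S.coeigen (Ideal.span {S.e b}) c) = if b = c then 1 else 0 := by
  have hval : ∀ φ ∈ S.coeigen (Ideal.span {S.e b}) c, ∀ r, φ r = S.χ c r * φ (S.gen b) := by
    intro φ hφ r
    rw [← hφ, S.smul_gen]
  split_ifs with h
  · subst h
    rw [← Module.finrank_self K]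
    refine LinearEquiv.finrank_eq
      { toFun := fun φ => φ.1 (S.gen b)
        invFun := fun k => ⟨k • ((S.χ b).toLinearMap ∘ₗ
          (Submodule.subtype (Ideal.span {S.e b})).restrictScalars K), fun r x => by
            simp; ring⟩
        map_add' := fun _ _ => rfl
        map_smul' := fun _ _ => rfl
        left_inv := fun φ => by
          ext r
          simp [hval φ.1 φ.2 r, mul_comm]
        right_inv := fun k => by simp [gen, S.χ_e] }
  · have h0 : ∀ φ ∈ S.coeigen (Ideal.span {S.e b}) c, φ = 0 := by
      intro φ hφ
      ext r
      rw [hval φ hφ, S.χ_of_mem_span_e r.2 (Ne.symm h)]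
      simp
    have : Subsingleton (S.coeigen (Ideal.span {S.e b}) c) :=
      ⟨fun φ ψ => Subtype.ext ((h0 _ φ.2).trans (h0 _ ψ.2).symm)⟩
    exact Module.finrank_zero_of_subsingleton

end Multiplicities

end SplitIdempotents

/-! ### Socles over symmetric algebras -/

/-- A nondegenerate symmetric associative bilinear form. -/
structure IsSymmetrizingForm {K R : Type*} [Field K] [Ring R] [Algebra K R]
    (B : R →ₗ[K] R →ₗ[K] K) : Prop where
  symm : ∀ a b, B a b = B b a
  assoc : ∀ a b c, B (a * b) c = B a (b * c)
  nondeg : ∀ a, (∀ b, B a b = 0) → a = 0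

namespace IsSymmetrizingForm

variable {K R : Type*} [Field K] [Ring R] [Algebra K R] {B : R →ₗ[K] R →ₗ[K] K}
  (hB : IsSymmetrizingForm B)
include hB

theorem mul_left_apply (y x r : R) : B (y * x) r = B x (r * y) := by
  rw [hB.assoc, hB.symm, hB.assoc]

theorem injective : Function.Injective B :=
  (injective_iff_map_eq_zero _).2 fun a ha => hB.nondeg a fun b => by rw [ha]; rfl

theorem bijective [FiniteDimensional K R] : Function.Bijective B :=
  ⟨hB.injective, (LinearMap.injective_iff_surjective_of_finrank_eq_finrank
    (Subspace.dual_finrank_eq (K := K) (V := R)).symm).1 hB.injective⟩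

end IsSymmetrizingForm

namespace SplitIdempotents

variable {K R ι : Type*} [Field K] [Ring R] [Algebra K R] [Fintype ι] [DecidableEq ι]
variable (S : SplitIdempotents K R ι) {B : R →ₗ[K] R →ₗ[K] K} (hB : IsSymmetrizingForm B)
include hB

theorem form_eigen {c : ι} {x : R} (hx : x ∈ S.eigen R c) (r : R) :
    B x r = S.χ c r * B x 1 := by
  have h := hB.mul_left_apply r x 1
  rw [one_mul] at h
  rw [← h, ← smul_eq_mul r x, hx r, map_smul, LinearMap.smul_apply, smul_eq_mul]

/-- The left socle also annihilates the radical on its right, because B (x * j) s = B x (j * s) is a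
multiple of χ c (j * s) = 0. -/
theorem eigen_mul_rad {c : ι} {x : R} (hx : x ∈ S.eigen R c) {j : R} (hj : j ∈ S.rad) :
    x * j = 0 := by
  refine hB.nondeg _ fun s => ?_
  rw [hB.assoc, S.form_eigen hB hx, map_mul, S.mem_rad.1 hj c, zero_mul, zero_mul]

theorem mem_eigen_of_form {c : ι} {x : R} (k : K) (hx : ∀ r, B x r = k * S.χ c r) :
    x ∈ S.eigen R c := by
  intro r
  rw [← sub_eq_zero]
  refine hB.nondeg _ fun s => ?_
  rw [map_sub, LinearMap.sub_apply, map_smul (B : R →ₗ[K] _) (S.χ c r) x, LinearMap.smul_apply,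
    smul_eq_mul r x, hB.mul_left_apply, hx, hx, map_mul, smul_eq_mul]
  ring

/-- The form identifies `R` with its dual, and the element representing `χ b` spans the socle of R
e_b. -/
theorem finrank_eigen_span_e [FiniteDimensional K R] (b c : ι) :
    Module.finrank K (S.eigen (Ideal.span {S.e b}) c) = if b = c then 1 else 0 := by
  have hval : ∀ x ∈ S.eigen (Ideal.span {S.e b}) c, (x : R) ∈ S.eigen R c := by
    intro x hx r
    exact congrArg Subtype.val (hx r)
  split_ifs with h
  · subst h
    obtain ⟨s, hs⟩ := hB.bijective.2 (S.χ b).toLinearMap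
    have hs' : ∀ r, B s r = S.χ b r := fun r => by rw [hs]; rfl
    have hse : s ∈ S.eigen R b := S.mem_eigen_of_form hB 1 (by simpa using hs')
    have hsb : s ∈ Ideal.span {S.e b} := by
      rw [mem_span_e, ← sub_eq_zero]
      refine hB.nondeg _ fun r => ?_
      rw [map_sub, LinearMap.sub_apply, hB.assoc, hs', hs', map_mul, S.χ_e_self, one_mul, sub_self]
    rw [finrank_eq_one_iff']
    refine ⟨⟨⟨s, hsb⟩, fun r => Subtype.ext (hse r)⟩, ?_, ?_⟩
    · intro h0
      have h1 : s = 0 := congrArg (fun x => (x.1.1 : R)) h0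
      have h2 := hs' 1
      simp [h1] at h2
    · rintro ⟨x, hx⟩
      refine ⟨B x 1, ?_⟩
      ext
      change B x 1 • s = x
      rw [← sub_eq_zero]
      refine hB.nondeg _ fun r => ?_
      rw [map_sub, LinearMap.sub_apply, map_smul, LinearMap.smul_apply, smul_eq_mul, hs',
        S.form_eigen hB (hval x hx) r]
      ring
  · have h0 : ∀ x ∈ S.eigen (Ideal.span {S.e b}) c, x = 0 := by
      intro x hx
      ext
      have h1 := S.mem_span_e.1 x.2
      refine hB.nondeg _ fun r => ?_
      rw [← h1, hB.assoc, S.form_eigen hB (hval x hx), map_mul, S.χ_e, if_neg (Ne.symm h)]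
      simp
    have : Subsingleton (S.eigen (Ideal.span {S.e b}) c) :=
      ⟨fun φ ψ => Subtype.ext ((h0 _ φ.2).trans (h0 _ ψ.2).symm)⟩
    exact Module.finrank_zero_of_subsingleton

variable {X Y : Type*} [AddCommGroup X] [Module K X] [Module R X] [IsScalarTower K R X]
  [AddCommGroup Y] [Module R Y]

/-- Decompose `X` into modules R e_b: a socle vector has coordinates in the left socle of `R`, and
these act on images lying in `rad • ⊤`, which `eigen_mul_rad` annihilates. -/
theorem map_eigen_eq_zero (hJ : S.rad ≤ Ring.jacobson R) [Module.Finite R X]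
    [Module.Projective R X] {f : X →ₗ[R] Y} (hf : ∀ x, f x ∈ (S.rad • ⊤ : Submodule R Y)) {c : ι}
    {x : X} (hx : x ∈ S.eigen X c) : f x = 0 := by
  obtain ⟨m, b, ⟨g⟩⟩ := S.exists_equiv_pi (X := X) hJ
  obtain ⟨r, rfl⟩ := g.surjective x
  have hr : ∀ k, (r k : R) ∈ S.eigen R c := by
    intro k s
    have h1 : s • r = S.χ c s • r := by
      apply g.injective
      rw [map_smul, hx s]
      exact ((g.restrictScalars K).map_smul _ _).symm
    exact congrArg Subtype.val (congrFun h1 k)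
  rw [S.pi_eq_sum_smul_gen b r, map_sum, map_sum]
  refine Finset.sum_eq_zero fun k _ => ?_
  rw [map_smul, map_smul]
  generalize hy : f (g (Pi.single k (S.gen (b k)))) = y
  have hy' : y ∈ (S.rad • ⊤ : Submodule R Y) := hy ▸ hf _
  clear hy
  induction hy' using Submodule.smul_induction_on' with
  | smul j hj n _ => rw [smul_smul, S.eigen_mul_rad hB (hr k) hj, zero_smul]
  | add y _ z _ hy hz => rw [smul_add, hy, hz, add_zero]

/-- Over a symmetric algebra R e_b has the same simple module as top and as socle. -/
theorem finrank_eigen_eq_finrank_coeigen [FiniteDimensional K R] (hJ : S.rad ≤ Ring.jacobson R)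
    [Module.Finite R X] [Module.Projective R X] (c : ι) :
    Module.finrank K (S.eigen X c) = Module.finrank K (S.coeigen X c) := by
  obtain ⟨m, b, ⟨g⟩⟩ := S.exists_equiv_pi (X := X) hJ
  rw [← S.finrank_eigen_congr g, ← S.finrank_coeigen_congr g, finrank_eigen_pi, finrank_coeigen_pi]
  refine Finset.sum_congr rfl fun k _ => ?_
  rw [S.finrank_eigen_span_e hB, S.finrank_coeigen_span_e]

omit hB in
theorem finrank_wt_eq_sum [FiniteDimensional K R] (hJ : S.rad ≤ Ring.jacobson R)
    [Module.Finite R X] [Module.Projective R X] (d : ι) :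
    Module.finrank K (S.wt X d) = ∑ c, Module.finrank K (S.coeigen X c) *
      Module.finrank K (S.wt (Ideal.span {S.e c}) d) := by
  obtain ⟨m, b, ⟨g⟩⟩ := S.exists_equiv_pi (X := X) hJ
  rw [← S.finrank_wt_congr g, finrank_wt_pi]
  simp_rw [← S.finrank_coeigen_congr g, finrank_coeigen_pi, S.finrank_coeigen_span_e,
    Finset.sum_mul]
  rw [Finset.sum_comm]
  refine Finset.sum_congr rfl fun k _ => ?_
  simp

omit hB in
theorem exists_equiv_span_e [FiniteDimensional K R] (hJ : S.rad ≤ Ring.jacobson R)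
    [Module.Finite R X] [Module.Projective R X] (a : ι)
    (h : ∀ c, Module.finrank K (S.coeigen X c) = if a = c then 1 else 0) :
    Nonempty (Ideal.span {S.e a} ≃ₗ[R] X) := by
  obtain ⟨m, b, ⟨g⟩⟩ := S.exists_equiv_pi (X := X) hJ
  simp_rw [← S.finrank_coeigen_congr g, finrank_coeigen_pi, S.finrank_coeigen_span_e] at h
  -- Summing the hypothesis over all `c` counts the summands.
  have hm : m = 1 := by
    have h1 := Finset.sum_congr rfl fun c (_ : c ∈ Finset.univ) => h c
    rw [Finset.sum_comm] at h1
    simpa using h1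
  subst hm
  have hb : b 0 = a := by
    have h1 := h a
    rw [Fin.sum_univ_one, if_pos rfl] at h1
    by_contra hne
    rw [if_neg hne] at h1
    exact zero_ne_one h1
  have e := (LinearEquiv.piUnique R fun k : Fin 1 => Ideal.span {S.e (b k)}).symm.trans g
  have hd : b default = a := hb
  rw [hd] at e
  exact ⟨e⟩

end SplitIdempotents

/-! ### Minimal projective presentations -/

namespace SplitIdempotents

variable {K R ι : Type*} [Field K] [Ring R] [Algebra K R] [Fintype ι] [DecidableEq ι]
variable (S : SplitIdempotents K R ι)

theorem radPart_e (i : ι) : S.radPart (S.e i) = 0 := by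
  simp [radPart_apply, S.χ_e]

theorem mul_e_eq (i : ι) (r : R) : r * S.e i = S.χ i r • S.e i + S.radPart r * S.e i := by
  conv_lhs => rw [S.eq_sum_add_radPart r, add_mul, Finset.sum_mul]
  simp [S.e_mul_e]

/-- Functionals on the radical that transform by `χ c` on the left and by `χ a` on the right,
extended by zero to the span of the idempotents. -/
def radForms (c a : ι) : Submodule K (R →ₗ[K] K) where
  carrier := {φ | (∀ i, φ (S.e i) = 0) ∧
    ∀ y ∈ S.rad, ∀ r s, φ (r * y * s) = S.χ c r * φ y * S.χ a s}
  add_mem' := by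
    rintro φ ψ ⟨h1, h2⟩ ⟨h3, h4⟩
    refine ⟨fun i => by simp [h1, h3], fun y hy r s => ?_⟩
    simp only [LinearMap.add_apply]
    rw [h2 y hy, h4 y hy]
    ring
  zero_mem' := by simp
  smul_mem' := by
    rintro k φ ⟨h1, h2⟩
    refine ⟨fun i => by simp [h1], fun y hy r s => ?_⟩
    simp only [LinearMap.smul_apply, smul_eq_mul]
    rw [h2 y hy]
    ring

variable {S} in
theorem radForms_radPart {c a : ι} {φ : R →ₗ[K] K} (hφ : φ ∈ S.radForms c a) (r : R) :
    φ (S.radPart r) = φ r := by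
  conv_rhs => rw [S.eq_sum_add_radPart r]
  simp [hφ.1]

/-- The radical of R e_a is `rad ⊓ Ideal.span {S.e a}`. Functionals on it extend to `R` along `r ↦
radPart r * e a`, with restriction as inverse. -/
theorem finrank_coeigen_rad_inf_span_e (c a : ι) :
    Module.finrank K (S.coeigen (S.rad ⊓ Ideal.span {S.e a} : Ideal R) c) =
      Module.finrank K (S.radForms c a) := by
  let N : Ideal R := S.rad ⊓ Ideal.span {S.e a}
  let f : R →ₗ[K] N :=
    { toFun := fun r => ⟨S.radPart r * S.e a, S.mul_mem_rad_right (S.radPart_mem r) _,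
        S.mem_span_e.2 (by rw [mul_assoc, e_mul_self])⟩
      map_add' := fun x y => Subtype.ext (by simp [add_mul])
      map_smul' := fun k x => Subtype.ext (by simp) }
  have hf : ∀ y : N, f y = y := fun y =>
    Subtype.ext (by
      change S.radPart y * S.e a = y
      rw [S.radPart_of_mem y.2.1, S.mem_span_e.1 y.2.2])
  have hfe : ∀ i, f (S.e i) = 0 := fun i => Subtype.ext (by
    change S.radPart (S.e i) * S.e a = 0
    rw [radPart_e, zero_mul])
  -- The correction term `(r * y) • f s` is invisible to `coeigen` because χ c y = 0.
  have hfm : ∀ y ∈ S.rad, ∀ r s, f (r * y * s) = S.χ a s • r • f y + (r * y) • f s := by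
    intro y hy r s
    ext
    change S.radPart (r * y * s) * S.e a = S.χ a s • (r * (S.radPart y * S.e a)) +
      r * y * (S.radPart s * S.e a)
    rw [S.radPart_of_mem hy,
      S.radPart_of_mem (S.mul_mem_rad_right (S.rad.mul_mem_left r hy) s), mul_assoc _ s,
      S.mul_e_eq a s, mul_add, mul_smul_comm, mul_assoc]
  refine LinearEquiv.finrank_eq
    { toFun := fun ψ => ⟨ψ.1 ∘ₗ f, fun i => by simp [hfe], fun y hy r s => by
        simp only [LinearMap.comp_apply, hfm y hy]
        rw [map_add, map_smul, ψ.2 r, ψ.2 (r * y), map_mul, S.mem_rad.1 hy c, smul_eq_mul]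
        ring⟩
      invFun := fun φ => ⟨φ.1 ∘ₗ (Submodule.subtype N).restrictScalars K, fun r y => by
        have h := φ.2.2 y y.2.1 r 1
        rw [mul_one, map_one, mul_one] at h
        exact h⟩
      map_add' := fun _ _ => rfl
      map_smul' := fun _ _ => rfl
      left_inv := fun ψ => by
        ext y
        exact congrArg ψ.1 (hf y)
      right_inv := fun φ => by
        ext r
        have h := φ.2.2 _ (S.radPart_mem r) 1 (S.e a)
        rw [map_one, S.χ_e_self, one_mul, one_mul, mul_one] at h
        exact h.trans (radForms_radPart φ.2 r) }

section OneDimensional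

variable {M : Type*} [AddCommGroup M] [Module K M] [Module R M] [IsScalarTower K R M]

variable (M) in
/-- `M` is one-dimensional with the algebra acting by `χ a`. -/
def IsSimpleAt (a : ι) : Prop :=
  Module.finrank K M = 1 ∧ S.eigen M a = ⊤

variable {S}

theorem IsSimpleAt.smul_eq {a : ι} (h : S.IsSimpleAt M a) (r : R) (m : M) :
    r • m = S.χ a r • m := (h.2 ▸ Submodule.mem_top : m ∈ S.eigen M a) r

theorem IsSimpleAt.finrank_eigen {a : ι} (h : S.IsSimpleAt M a) (c : ι) :
    Module.finrank K (S.eigen M c) = if a = c then 1 else 0 := by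
  split_ifs with hac
  · rw [← hac, h.2, finrank_top, h.1]
  · have : S.eigen M c = ⊥ := by
      rw [eq_bot_iff]
      intro m hm
      have h1 := hm (S.e a)
      rw [h.smul_eq, S.χ_e_self, S.χ_e, if_neg (Ne.symm hac), one_smul, zero_smul] at h1
      exact h1
    rw [this, finrank_bot]

theorem IsSimpleAt.finrank_wt {a : ι} (h : S.IsSimpleAt M a) (c : ι) :
    Module.finrank K (S.wt M c) = if a = c then 1 else 0 := by
  split_ifs with hac
  · have : S.wt M c = ⊤ := by
      rw [eq_top_iff]
      intro m _
      rw [mem_wt, h.smul_eq, hac, S.χ_e_self, one_smul]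
    rw [this, finrank_top, h.1]
  · have : S.wt M c = ⊥ := by
      rw [eq_bot_iff]
      intro m hm
      rw [mem_wt, h.smul_eq, S.χ_e, if_neg hac, zero_smul] at hm
      exact hm.symm
    rw [this, finrank_bot]

theorem IsSimpleAt.finrank_coeigen {a : ι} (h : S.IsSimpleAt M a) (c : ι) :
    Module.finrank K (S.coeigen M c) = if a = c then 1 else 0 := by
  have : FiniteDimensional K M := FiniteDimensional.of_finrank_eq_succ h.1
  split_ifs with hac
  · have : S.coeigen M c = ⊤ := by
      rw [eq_top_iff]
      intro φ _ r m
      rw [h.smul_eq, map_smul, hac, smul_eq_mul]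
    rw [this, finrank_top]
    exact Subspace.dual_finrank_eq.trans h.1
  · have h0 := S.finrank_coeigen_le_wt (X := M) c
    rw [h.finrank_wt, if_neg hac] at h0
    omega

end OneDimensional

/-- A short exact sequence `M' → X → M` with `X` a finitely generated projective module and the
image of `M'` in the radical of `X`. -/
structure IsCoverSequence {M' X M : Type*} [AddCommGroup M'] [Module R M'] [AddCommGroup X]
    [Module R X] [AddCommGroup M] [Module R M] (f : M' →ₗ[R] X) (g : X →ₗ[R] M) : Prop where
  inj : Function.Injective f
  exact : Function.Exact f g
  surj : Function.Surjective g
  proj : Module.Projective R X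
  finite : Module.Finite R X
  minimal : ∀ m, f m ∈ (S.rad • ⊤ : Submodule R X)

namespace IsCoverSequence

variable {S}
variable {M' X M Y N : Type*} [AddCommGroup M'] [Module K M'] [Module R M'] [IsScalarTower K R M']
  [AddCommGroup X] [Module K X] [Module R X] [IsScalarTower K R X]
  [AddCommGroup M] [Module K M] [Module R M] [IsScalarTower K R M]
  [AddCommGroup Y] [Module K Y] [Module R Y] [IsScalarTower K R Y]
  [AddCommGroup N] [Module K N] [Module R N] [IsScalarTower K R N]
  {f : M' →ₗ[R] X} {g : X →ₗ[R] M}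

theorem finrank_wt [FiniteDimensional K R] (h : S.IsCoverSequence f g) (d : ι) :
    Module.finrank K (S.wt X d) = Module.finrank K (S.wt M d) + Module.finrank K (S.wt M' d) := by
  have := h.finite
  have : FiniteDimensional K X := Module.Finite.trans R X
  rw [← LinearMap.finrank_range_add_finrank_ker (S.wtMap g d)]
  congr 1
  · rw [LinearMap.range_eq_top.2, finrank_top]
    rintro ⟨m, hm⟩
    obtain ⟨x, rfl⟩ := h.surj m
    refine ⟨⟨S.e d • x, S.e_smul_mem_wt d x⟩, Subtype.ext ?_⟩
    change g (S.e d • x) = g x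
    rw [map_smul, hm]
  · have h1 : LinearMap.ker (S.wtMap g d) = LinearMap.range (S.wtMap f d) := by
      ext ⟨x, hx⟩
      rw [LinearMap.mem_ker, LinearMap.mem_range]
      constructor
      · intro h0
        obtain ⟨m, rfl⟩ := (h.exact x).1 (congrArg Subtype.val h0)
        refine ⟨⟨m, h.inj ?_⟩, rfl⟩
        rw [map_smul]
        exact hx
      · rintro ⟨m, hm⟩
        have : f m = x := congrArg Subtype.val hm
        ext
        change g x = 0
        rw [← this]
        exact h.exact.apply_apply_eq_zero _
    rw [h1]
    refine LinearMap.finrank_range_of_inj ?_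
    intro x y hxy
    exact Subtype.ext (h.inj (congrArg Subtype.val hxy))

/-- The kernel of `g` lies in the radical, where functionals of `coeigen X c` vanish; so they
descend to `M`. -/
theorem finrank_coeigen (h : S.IsCoverSequence f g) (c : ι) :
    Module.finrank K (S.coeigen X c) = Module.finrank K (S.coeigen M c) := by
  symm
  let F : S.coeigen M c →ₗ[K] S.coeigen X c :=
    ((g.restrictScalars K).dualMap).restrict fun φ hφ r x => by
      simp only [LinearMap.dualMap_apply, LinearMap.coe_restrictScalars, map_smul]
      exact hφ r _
  refine LinearEquiv.finrank_eq (LinearEquiv.ofBijective F ⟨?_, ?_⟩)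
  · intro φ ψ hφψ
    ext m
    obtain ⟨x, rfl⟩ := h.surj m
    exact LinearMap.congr_fun (congrArg Subtype.val hφψ) x
  · rintro ⟨φ, hφ⟩
    have hker : LinearMap.ker (g.restrictScalars K) ≤ LinearMap.ker φ := by
      intro x hx
      obtain ⟨m, rfl⟩ := (h.exact x).1 hx
      exact S.coeigen_rad hφ (h.minimal m)
    let ψ : M →ₗ[K] K := (LinearMap.ker (g.restrictScalars K)).liftQ φ hker ∘ₗ
      ((g.restrictScalars K).quotKerEquivOfSurjective h.surj).symm.toLinearMap
    have hψ : ∀ x, ψ (g x) = φ x := by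
      intro x
      have : ((g.restrictScalars K).quotKerEquivOfSurjective h.surj).symm (g x) =
          Submodule.Quotient.mk x := by
        rw [LinearEquiv.symm_apply_eq]
        rfl
      change (LinearMap.ker (g.restrictScalars K)).liftQ φ hker
        (((g.restrictScalars K).quotKerEquivOfSurjective h.surj).symm (g x)) = φ x
      rw [this]
      rfl
    refine ⟨⟨ψ, fun r m => ?_⟩, ?_⟩
    · obtain ⟨x, rfl⟩ := h.surj m
      rw [← map_smul, hψ, hψ, hφ]
    · ext x
      exact hψ x

/-- The composite `f' ∘ g` has image in the radical of `Y`, so it kills the socle of `X`. As `f'` is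
injective, the socle of `X` already lies in the image of `M'`. -/
theorem finrank_eigen {B : R →ₗ[K] R →ₗ[K] K} (hB : IsSymmetrizingForm B)
    (hJ : S.rad ≤ Ring.jacobson R) (h : S.IsCoverSequence f g) {f' : M →ₗ[R] Y} {g' : Y →ₗ[R] N}
    (h' : S.IsCoverSequence f' g') (c : ι) :
    Module.finrank K (S.eigen X c) = Module.finrank K (S.eigen M' c) := by
  symm
  have := h.finite
  have := h.proj
  let F : S.eigen M' c →ₗ[K] S.eigen X c :=
    (f.restrictScalars K).restrict fun m hm r => by
      rw [LinearMap.coe_restrictScalars, ← map_smul f, hm r]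
      exact (f.restrictScalars K).map_smul _ _
  refine LinearEquiv.finrank_eq (LinearEquiv.ofBijective F ⟨?_, ?_⟩)
  · intro x y hxy
    exact Subtype.ext (h.inj (congrArg Subtype.val hxy))
  · rintro ⟨x, hx⟩
    have h0 : f' (g x) = 0 := S.map_eigen_eq_zero hB hJ (f := f' ∘ₗ g)
      (fun x => h'.minimal (g x)) hx
    obtain ⟨m, rfl⟩ := (h.exact x).1 (h'.inj (h0.trans (map_zero f').symm))
    refine ⟨⟨m, fun r => h.inj ?_⟩, rfl⟩
    rw [map_smul, hx r]
    exact ((f.restrictScalars K).map_smul _ _).symm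

/-- A simple top at `a` forces `X` to be R e_a, and then `M'` is the radical of R e_a. -/
theorem finrank_coeigen_of_isSimpleAt [FiniteDimensional K R] (hJ : S.rad ≤ Ring.jacobson R)
    (h : S.IsCoverSequence f g) {a : ι} (hM : S.IsSimpleAt M a) (c : ι) :
    Module.finrank K (S.coeigen M' c) = Module.finrank K (S.radForms c a) := by
  have := h.finite
  have := h.proj
  obtain ⟨p⟩ := S.exists_equiv_span_e (X := X) hJ a fun c => by
    rw [h.finrank_coeigen, hM.finrank_coeigen]
  have hgen : g (p (S.gen a)) ≠ 0 := by
    intro h0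
    have : ∀ m : M, m = 0 := by
      intro m
      obtain ⟨x, rfl⟩ := h.surj m
      obtain ⟨r, rfl⟩ := p.surjective x
      rw [← S.smul_gen r, map_smul, map_smul, h0, smul_zero]
    have : Subsingleton M := ⟨fun x y => (this x).trans (this y).symm⟩
    have := hM.1
    rw [Module.finrank_zero_of_subsingleton] at this
    exact zero_ne_one this
  have hker : ∀ r : Ideal.span {S.e a}, g (p r) = 0 ↔ (r : R) ∈ S.rad := by
    intro r
    have h1 : g (p r) = S.χ a r • g (p (S.gen a)) := by
      conv_lhs => rw [← S.smul_gen r, map_smul, map_smul, hM.smul_eq]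
    rw [h1, smul_eq_zero, or_iff_left hgen, mem_rad]
    constructor
    · intro h2 i
      by_cases hi : i = a
      · rw [hi, h2]
      · exact S.χ_of_mem_span_e r.2 hi
    · intro h2
      exact h2 a
  let F : M' →ₗ[R] (S.rad ⊓ Ideal.span {S.e a} : Ideal R) :=
    LinearMap.codRestrict _ (Submodule.subtype _ ∘ₗ p.symm.toLinearMap ∘ₗ f) fun m =>
      ⟨(hker _).1 (by
        simp only [LinearMap.coe_comp, LinearEquiv.coe_coe, Function.comp_apply,
          LinearEquiv.apply_symm_apply]
        exact h.exact.apply_apply_eq_zero m), (p.symm (f m)).2⟩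
  rw [← finrank_coeigen_rad_inf_span_e]
  refine S.finrank_coeigen_congr (LinearEquiv.ofBijective F ⟨?_, ?_⟩) c
  · intro x y hxy
    exact h.inj (p.symm.injective (Subtype.ext (congrArg (fun z => (z.1 : R)) hxy)))
  · rintro ⟨r, hr⟩
    obtain ⟨m, hm⟩ := (h.exact _).1 ((hker ⟨r, hr.2⟩).2 hr.1)
    refine ⟨m, Subtype.ext ?_⟩
    change (p.symm (f m)).1 = r
    rw [hm, LinearEquiv.symm_apply_apply]

theorem finrank_wt_of_isSimpleAt [FiniteDimensional K R] (hJ : S.rad ≤ Ring.jacobson R)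
    (h : S.IsCoverSequence f g) {a : ι} (hM : S.IsSimpleAt M a) (d : ι) :
    Module.finrank K (S.wt (Ideal.span {S.e a}) d) =
      (if a = d then 1 else 0) + Module.finrank K (S.wt M' d) := by
  have := h.finite
  have := h.proj
  obtain ⟨p⟩ := S.exists_equiv_span_e (X := X) hJ a fun c => by
    rw [h.finrank_coeigen, hM.finrank_coeigen]
  rw [S.finrank_wt_congr p, h.finrank_wt, hM.finrank_wt]

section Socle

variable {B : R →ₗ[K] R →ₗ[K] K} (hB : IsSymmetrizingForm B)
include hB

/-- For `x` in R e_a the functional `B x` depends only on its values at `e a` and on the radical; if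
it vanishes on the radical it is a multiple of `χ a`. -/
theorem mem_eigen_iff_form_rad {a : ι} (x : Ideal.span {S.e a}) :
    x ∈ S.eigen (Ideal.span {S.e a}) a ↔ ∀ y ∈ S.rad, B x y = 0 := by
  have hx : (x : R) * S.e a = x := S.mem_span_e.1 x.2
  constructor
  · intro h y hy
    have h1 : (x : R) ∈ S.eigen R a := fun r => congrArg Subtype.val (h r)
    rw [S.form_eigen hB h1, S.mem_rad.1 hy, zero_mul]
  · intro h r
    ext
    refine S.mem_eigen_of_form hB (B x (S.e a)) (fun s => ?_) r
    conv_lhs => rw [← hx, hB.assoc, S.e_mul_eq, map_add, map_smul,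
      h _ (S.rad.mul_mem_left _ (S.radPart_mem s)), add_zero, smul_eq_mul, mul_comm]

/-- Here `M` is R e_a modulo its socle. Restricting `B x` to the radical depends only on, and
determines, the class of `x`; the class is in the socle at `c` exactly when this functional
transforms by `χ c` on the right and, as then follows, by `χ a` on the left. -/
theorem finrank_eigen_quotient [FiniteDimensional K R] {a : ι} (p : Ideal.span {S.e a} →ₗ[R] M)
    (hp : Function.Surjective p) (hker : ∀ x, p x = 0 ↔ x ∈ S.eigen (Ideal.span {S.e a}) a)
    (c : ι) : Module.finrank K (S.eigen M c) = Module.finrank K (S.radForms a c) := by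
  symm
  let D : R ≃ₗ[K] (R →ₗ[K] K) := LinearEquiv.ofBijective B hB.bijective
  have hD : ∀ φ r, B (D.symm φ) r = φ r := fun φ r =>
    LinearMap.congr_fun (D.apply_symm_apply φ) r
  let q : R →ₗ[K] Ideal.span {S.e a} :=
    { toFun := fun x => ⟨x * S.e a, S.mem_span_e.2 (by rw [mul_assoc, e_mul_self])⟩
      map_add' := fun x y => Subtype.ext (add_mul _ _ _)
      map_smul' := fun k x => Subtype.ext (smul_mul_assoc _ _ _) }
  have hq : ∀ φ ∈ S.radForms a c, ∀ y ∈ S.rad, B (q (D.symm φ)) y = φ y := by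
    intro φ hφ y hy
    change B (D.symm φ * S.e a) y = φ y
    have h := hφ.2 y hy (S.e a) 1
    rw [mul_one, S.χ_e_self, map_one, one_mul, mul_one] at h
    rw [hB.assoc, hD, h]
  have hpK : ∀ (k : K) x, p (k • x) = k • p x := fun k x => (p.restrictScalars K).map_smul k x
  let F : S.radForms a c →ₗ[K] S.eigen M c :=
    LinearMap.restrict ((p.restrictScalars K) ∘ₗ q ∘ₗ D.symm.toLinearMap) fun φ hφ r => by
      change r • p (q (D.symm φ)) = S.χ c r • p (q (D.symm φ))
      rw [← map_smul, ← hpK, ← sub_eq_zero, ← map_sub, hker, mem_eigen_iff_form_rad hB]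
      intro y hy
      change B (r * (q (D.symm φ) : R) - S.χ c r • (q (D.symm φ) : R)) y = 0
      have h := hφ.2 y hy 1 r
      rw [map_one, one_mul, one_mul] at h
      rw [map_sub, LinearMap.sub_apply, hB.mul_left_apply, map_smul, LinearMap.smul_apply,
        hq φ hφ y hy, hq φ hφ _ (S.mul_mem_rad_right hy r), h, smul_eq_mul, mul_comm, sub_self]
  refine LinearEquiv.finrank_eq (LinearEquiv.ofBijective F ⟨?_, ?_⟩)
  · refine (injective_iff_map_eq_zero _).2 ?_
    rintro ⟨φ, hφ⟩ h0
    have h1 : p (q (D.symm φ)) = 0 := congrArg Subtype.val h0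
    rw [hker, mem_eigen_iff_form_rad hB] at h1
    ext r
    change φ r = 0
    rw [← radForms_radPart hφ, ← hq φ hφ _ (S.radPart_mem r), h1 _ (S.radPart_mem r)]
  · rintro ⟨m, hm⟩
    obtain ⟨x, rfl⟩ := hp m
    have hx : (x : R) * S.e a = x := S.mem_span_e.1 x.2
    have hxr : ∀ r, ∀ y ∈ S.rad, B x (y * r) = B x y * S.χ c r := by
      intro r y hy
      have h1 := hm r
      rw [← map_smul, ← hpK, ← sub_eq_zero, ← map_sub, hker, mem_eigen_iff_form_rad hB] at h1
      have h2 := h1 y hy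
      change B (r * (x : R) - S.χ c r • (x : R)) y = 0 at h2
      rw [map_sub, LinearMap.sub_apply, hB.mul_left_apply, map_smul, LinearMap.smul_apply,
        sub_eq_zero, smul_eq_mul, mul_comm] at h2
      exact h2
    -- Since x = x * e a, only `e a * r` matters; its radical part contributes a multiple of χ c y =
    -- 0 by `hxr`.
    have hxl : ∀ r, ∀ y ∈ S.rad, B x (r * y) = S.χ a r * B x y := by
      intro r y hy
      have h1 : ∀ z, B x (S.e a * z) = B x z := fun z => by rw [← hB.assoc, hx]
      rw [← h1 (r * y), ← mul_assoc, S.e_mul_eq a r, add_mul, map_add, smul_mul_assoc, map_smul,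
        h1 y, mul_assoc, h1, hxr y _ (S.radPart_mem r), S.mem_rad.1 hy, mul_zero, add_zero,
        smul_eq_mul]
    have hmem : B x ∘ₗ S.radPart ∈ S.radForms a c := by
      refine ⟨fun i => by simp [radPart_e], fun y hy r s => ?_⟩
      have h1 : r * y ∈ S.rad := S.rad.mul_mem_left r hy
      change B x (S.radPart (r * y * s)) = S.χ a r * B x (S.radPart y) * S.χ c s
      rw [S.radPart_of_mem hy, S.radPart_of_mem (S.mul_mem_rad_right h1 s), hxr _ _ h1, hxl _ _ hy]
    refine ⟨⟨_, hmem⟩, Subtype.ext ?_⟩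
    change p (q (D.symm (B x ∘ₗ S.radPart))) = p x
    rw [← sub_eq_zero, ← map_sub, hker, mem_eigen_iff_form_rad hB]
    intro y hy
    change B ((q (D.symm (B x ∘ₗ S.radPart)) : R) - x) y = 0
    rw [map_sub, LinearMap.sub_apply, hq _ hmem y hy, LinearMap.comp_apply, S.radPart_of_mem hy,
      sub_self]

/-- The socle of `X` is that of `M'`, hence simple at `a`. So `X` is R e_a and `M` is its quotient
by the socle. -/
theorem finrank_eigen_of_isSimpleAt [FiniteDimensional K R] (hJ : S.rad ≤ Ring.jacobson R)
    (h : S.IsCoverSequence f g) {f' : M →ₗ[R] Y} {g' : Y →ₗ[R] N} (h' : S.IsCoverSequence f' g')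
    {a : ι} (hM : S.IsSimpleAt M' a) (c : ι) :
    Nonempty (Ideal.span {S.e a} ≃ₗ[R] X) ∧
      Module.finrank K (S.eigen M c) = Module.finrank K (S.radForms a c) := by
  have := h.finite
  have := h.proj
  obtain ⟨p⟩ := S.exists_equiv_span_e (X := X) hJ a fun c => by
    rw [← S.finrank_eigen_eq_finrank_coeigen hB hJ, h.finrank_eigen hB hJ h', hM.finrank_eigen]
  have : Module.Projective R (Ideal.span {S.e a}) := Module.Projective.of_equiv p.symm
  refine ⟨⟨p⟩, finrank_eigen_quotient hB (g ∘ₗ p.toLinearMap)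
    (h.surj.comp p.surjective) (fun x => ?_) c⟩
  constructor
  · intro hx r
    obtain ⟨m, hm⟩ := (h.exact _).1 hx
    apply p.injective
    change f m = p x at hm
    rw [map_smul, ← hm, ← map_smul, hM.smul_eq]
    refine ((f.restrictScalars K).map_smul _ _).trans ?_
    refine Eq.trans ?_ ((p.restrictScalars K).map_smul _ _).symm
    exact congrArg _ hm
  · intro hx
    apply h'.inj
    rw [map_zero]
    exact S.map_eigen_eq_zero hB hJ (f := f' ∘ₗ g ∘ₗ p.toLinearMap) (fun x => h'.minimal _) hx

end Socle

end IsCoverSequence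

section PeriodFour

variable {M₀ M₁ M₂ M₃ M₄ X₀ X₁ X₂ X₃ : Type*}
  [AddCommGroup M₀] [Module K M₀] [Module R M₀] [IsScalarTower K R M₀]
  [AddCommGroup M₁] [Module K M₁] [Module R M₁] [IsScalarTower K R M₁]
  [AddCommGroup M₂] [Module K M₂] [Module R M₂] [IsScalarTower K R M₂]
  [AddCommGroup M₃] [Module K M₃] [Module R M₃] [IsScalarTower K R M₃]
  [AddCommGroup M₄] [Module K M₄] [Module R M₄] [IsScalarTower K R M₄]
  [AddCommGroup X₀] [Module K X₀] [Module R X₀] [IsScalarTower K R X₀]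
  [AddCommGroup X₁] [Module K X₁] [Module R X₁] [IsScalarTower K R X₁]
  [AddCommGroup X₂] [Module K X₂] [Module R X₂] [IsScalarTower K R X₂]
  [AddCommGroup X₃] [Module K X₃] [Module R X₃] [IsScalarTower K R X₃]
  {f₀ : M₁ →ₗ[R] X₀} {g₀ : X₀ →ₗ[R] M₀} {f₁ : M₂ →ₗ[R] X₁} {g₁ : X₁ →ₗ[R] M₁}
  {f₂ : M₃ →ₗ[R] X₂} {g₂ : X₂ →ₗ[R] M₂} {f₃ : M₄ →ₗ[R] X₃} {g₃ : X₃ →ₗ[R] M₃}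

/-- The Cartan identities for a simple module of period four over a symmetric algebra. -/
theorem cartan_of_period_four [FiniteDimensional K R] {B : R →ₗ[K] R →ₗ[K] K}
    (hB : IsSymmetrizingForm B) (hJ : S.rad ≤ Ring.jacobson R)
    (h₀ : S.IsCoverSequence f₀ g₀) (h₁ : S.IsCoverSequence f₁ g₁) (h₂ : S.IsCoverSequence f₂ g₂)
    (h₃ : S.IsCoverSequence f₃ g₃) {a : ι} (hM₀ : S.IsSimpleAt M₀ a) (hM₄ : S.IsSimpleAt M₄ a)
    (d : ι) :
    ∑ c, Module.finrank K (S.radForms c a) * Module.finrank K (S.wt (Ideal.span {S.e c}) d) =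
      ∑ c, Module.finrank K (S.radForms a c) * Module.finrank K (S.wt (Ideal.span {S.e c}) d) ∧
    Module.finrank K (S.wt (Ideal.span {S.e a}) d) + Module.finrank K (S.radForms a d) ≤
      ∑ c, Module.finrank K (S.radForms c a) * Module.finrank K (S.wt (Ideal.span {S.e c}) d) +
        if a = d then 1 else 0 := by
  have := h₁.finite
  have := h₁.proj
  have := h₂.finite
  have := h₂.proj
  obtain ⟨⟨p⟩, -⟩ := h₃.finrank_eigen_of_isSimpleAt hB hJ h₂ hM₄ a
  have hM₃ := fun c => (h₃.finrank_eigen_of_isSimpleAt hB hJ h₂ hM₄ c).2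
  have hX₁ : ∀ c, Module.finrank K (S.coeigen X₁ c) = Module.finrank K (S.radForms c a) :=
    fun c => by rw [h₁.finrank_coeigen, h₀.finrank_coeigen_of_isSimpleAt hJ hM₀]
  -- The top of `X₂` is read off from its socle, which is the socle of `M₃`, that is, of R e_a
  -- modulo its own socle.
  have hX₂ : ∀ c, Module.finrank K (S.coeigen X₂ c) = Module.finrank K (S.radForms a c) :=
    fun c => by
      rw [← S.finrank_eigen_eq_finrank_coeigen hB hJ, h₂.finrank_eigen hB hJ h₁, hM₃]
  have e₀ := h₀.finrank_wt_of_isSimpleAt hJ hM₀ d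
  have e₁ := h₁.finrank_wt d
  have e₂ := h₂.finrank_wt d
  have e₃ := h₃.finrank_wt d
  rw [← S.finrank_wt_congr p, hM₄.finrank_wt] at e₃
  have : Module.Finite R M₂ := Module.Finite.of_surjective g₂ h₂.surj
  have : FiniteDimensional K M₂ := Module.Finite.trans R M₂
  -- The top of `M₂` bounds its weight space from below; this is the source of the inequality, while
  -- the equality is the alternating sum of dimensions.
  have e₄ := S.finrank_coeigen_le_wt (X := M₂) d
  rw [← h₂.finrank_coeigen, hX₂] at e₄
  have s₁ := S.finrank_wt_eq_sum (X := X₁) hJ d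
  have s₂ := S.finrank_wt_eq_sum (X := X₂) hJ d
  simp_rw [hX₁] at s₁
  simp_rw [hX₂] at s₂
  rw [← s₁, ← s₂]
  omega

end PeriodFour

end SplitIdempotents

/-! ### Fibres of bimodules -/

namespace SplitIdempotents

section Superfluous

variable {K R ι : Type*} [Field K] [Ring R] [Algebra K R] [Fintype ι] [DecidableEq ι]
variable (S : SplitIdempotents K R ι)

/-- If k in `N` lies outside `rad • ⊤`, so does some e i • k, and a functional φ separates it from
`rad • ⊤`. The vectors x with φ (e i • x) = 0 form a proper submodule of codimension one over `K`,
which together with `N` spans everything. -/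
theorem superfluous_le_rad_smul_top {X : Type*} [AddCommGroup X] [Module R X] {N : Submodule R X}
    (hN : ∀ N' : Submodule R X, N' ⊔ N = ⊤ → N' = ⊤) : N ≤ S.rad • ⊤ := by
  let _ : Module K X := Module.compHom X (algebraMap K R)
  have : IsScalarTower K R X := ⟨fun k r x => by
    rw [Algebra.smul_def, mul_smul]
    rfl⟩
  intro k hk
  by_contra hkW
  obtain ⟨i, hi⟩ : ∃ i, S.e i • k ∉ (S.rad • ⊤ : Submodule R X) := by
    by_contra! h
    apply hkW
    rw [← one_smul R k, ← S.sum_e, Finset.sum_smul]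
    exact Submodule.sum_mem _ fun i _ => h i
  obtain ⟨φ, hφk, hφ⟩ := Submodule.exists_le_ker_of_notMem
    (p := (S.rad • ⊤ : Submodule R X).restrictScalars K) hi
  have hφ0 : ∀ j ∈ S.rad, ∀ x : X, φ (S.e i • j • x) = 0 := fun j hj x =>
    hφ (Submodule.smul_mem _ _ (Submodule.smul_mem_smul hj Submodule.mem_top))
  let N' : Submodule R X :=
    { carrier := {x | φ (S.e i • x) = 0}
      add_mem' := fun {x y} hx hy => by
        simp only [Set.mem_ofPred_eq] at *
        rw [smul_add, map_add, hx, hy, add_zero]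
      zero_mem' := by simp
      smul_mem' := fun r x hx => by
        simp only [Set.mem_ofPred_eq] at *
        rw [smul_smul, S.e_mul_eq, add_smul, map_add, mul_smul, hφ0 _ (S.radPart_mem r),
          smul_assoc, map_smul, hx, smul_zero, add_zero] }
  have h1 : N' = ⊤ := by
    apply hN
    rw [eq_top_iff]
    intro x _
    have hk' : S.e i • k ∈ N := N.smul_mem _ hk
    set c : K := φ (S.e i • x) / φ (S.e i • k)
    have hx : x = (x - c • S.e i • k) + c • S.e i • k := by abel
    rw [hx]
    refine Submodule.add_mem_sup ?_ ?_
    · change φ (S.e i • (x - c • S.e i • k)) = 0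
      rw [smul_sub, ← algebraMap_smul R c, smul_smul (S.e i), ← Algebra.commutes, ← smul_smul,
        smul_smul (S.e i), e_mul_self, algebraMap_smul, map_sub, map_smul φ c, smul_eq_mul,
        div_mul_cancel₀ _ hφk, sub_self]
    · rw [← algebraMap_smul R c]
      exact N.smul_mem _ hk'
  have h2 : k ∈ N' := h1 ▸ Submodule.mem_top
  exact hφk h2

end Superfluous

variable {K A ι : Type*} [Field K] [Ring A] [Algebra K A] [Fintype ι] [DecidableEq ι]
variable (S : SplitIdempotents K A ι)

/-- The characters as characters of the opposite algebra. -/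
def χop (a : ι) : Aᵐᵒᵖ →ₐ[K] K := (S.χ a).fromOpposite fun _ _ => Commute.all _ _

theorem χop_apply (a : ι) (z : Aᵐᵒᵖ) : S.χop a z = S.χ a z.unop := rfl

/-- The product system on the enveloping algebra. -/
def enveloping : SplitIdempotents K (A ⊗[K] Aᵐᵒᵖ) (ι × ι) where
  e p := S.e p.1 ⊗ₜ MulOpposite.op (S.e p.2)
  χ p := Algebra.TensorProduct.lift (S.χ p.1) (S.χop p.2) fun _ _ => Commute.all _ _
  χ_e p q := by
    simp only [Algebra.TensorProduct.lift_tmul, χop_apply, MulOpposite.unop_op, S.χ_e, Prod.ext_iff]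
    split_ifs <;> simp_all
  e_mul_e p q := by
    simp only [Algebra.TensorProduct.tmul_mul_tmul, ← MulOpposite.op_mul, S.e_mul_e, Prod.ext_iff]
    by_cases h1 : p.1 = q.1 <;> by_cases h2 : p.2 = q.2 <;> simp [h1, h2, Ne.symm]
  sum_e := by
    rw [Fintype.sum_prod_type]
    simp_rw [← TensorProduct.tmul_sum, ← TensorProduct.sum_tmul]
    rw [← Finset.op_sum, S.sum_e]
    rfl

theorem enveloping_χ_tmul (p : ι × ι) (y : A) (z : Aᵐᵒᵖ) :
    S.enveloping.χ p (y ⊗ₜ z) = S.χ p.1 y * S.χ p.2 z.unop :=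
  Algebra.TensorProduct.lift_tmul (hfg := fun _ _ => Commute.all _ _) ..

/-- The evaluation of the right-hand factor at the character `χ a`. -/
def rightEval (a : ι) : A ⊗[K] Aᵐᵒᵖ →ₐ[K] A :=
  Algebra.TensorProduct.lift (AlgHom.id K A) ((Algebra.ofId K A).comp (S.χop a))
    fun _ _ => Algebra.commute_algebraMap_right _ _

theorem rightEval_tmul (a : ι) (y : A) (z : Aᵐᵒᵖ) :
    S.rightEval a (y ⊗ₜ z) = S.χ a z.unop • y := by
  rw [Algebra.smul_def, Algebra.commutes]
  exact Algebra.TensorProduct.lift_tmul ..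

theorem χ_rightEval (a c : ι) (b : A ⊗[K] Aᵐᵒᵖ) :
    S.χ c (S.rightEval a b) = S.enveloping.χ (c, a) b := by
  induction b using TensorProduct.induction_on with
  | zero => simp
  | add x y hx hy => rw [map_add, map_add, hx, hy, map_add]
  | tmul y z =>
    rw [rightEval_tmul, map_smul, smul_eq_mul, mul_comm, enveloping_χ_tmul]

theorem rightEval_mem_rad (a : ι) {b : A ⊗[K] Aᵐᵒᵖ} (hb : b ∈ S.enveloping.rad) :
    S.rightEval a b ∈ S.rad := by
  rw [mem_rad] at *
  intro c
  rw [χ_rightEval, hb]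

/-- The left module `P ⊗ (A ⧸ ker χ a)` of a bimodule `P`. -/
def Fiber (a : ι) (P : Type*) [AddCommGroup P] [Module (A ⊗[K] Aᵐᵒᵖ) P] : Type _ :=
  P ⧸ (RingHom.ker (S.rightEval a) • ⊤ : Submodule (A ⊗[K] Aᵐᵒᵖ) P)

namespace Fiber

variable {S} {a : ι}
variable {P Q L N : Type*} [AddCommGroup P] [Module (A ⊗[K] Aᵐᵒᵖ) P]
  [AddCommGroup Q] [Module (A ⊗[K] Aᵐᵒᵖ) Q] [AddCommGroup L] [Module (A ⊗[K] Aᵐᵒᵖ) L]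
  [AddCommGroup N] [Module (A ⊗[K] Aᵐᵒᵖ) N]

instance : AddCommGroup (S.Fiber a P) := inferInstanceAs
  (AddCommGroup (P ⧸ (RingHom.ker (S.rightEval a) • ⊤ : Submodule (A ⊗[K] Aᵐᵒᵖ) P)))

instance : Module A (S.Fiber a P) :=
  Module.compHom (P ⧸ (RingHom.ker (S.rightEval a) • ⊤ : Submodule (A ⊗[K] Aᵐᵒᵖ) P))
    (Algebra.TensorProduct.includeLeft : A →ₐ[K] A ⊗[K] Aᵐᵒᵖ).toRingHom

instance : Module K (S.Fiber a P) := Module.compHom _ (algebraMap K A)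

instance : IsScalarTower K A (S.Fiber a P) := ⟨fun k r x => by
  rw [Algebra.smul_def, mul_smul]
  rfl⟩

theorem sub_mem_ker (b : A ⊗[K] Aᵐᵒᵖ) : b - S.rightEval a b ⊗ₜ 1 ∈ RingHom.ker (S.rightEval a) := by
  rw [RingHom.mem_ker, map_sub, rightEval_tmul]
  simp

variable (S a P) in
/-- The projection of a bimodule onto its fibre. -/
def mk : P →ₛₗ[(S.rightEval a : A ⊗[K] Aᵐᵒᵖ →+* A)] S.Fiber a P where
  toFun p := Submodule.Quotient.mk p
  map_add' _ _ := rfl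
  map_smul' b p := by
    refine (Submodule.Quotient.eq _).2 ?_
    change b • p - (S.rightEval a b ⊗ₜ[K] (1 : Aᵐᵒᵖ)) • p ∈ _
    rw [← sub_smul]
    exact Submodule.smul_mem_smul (sub_mem_ker b) Submodule.mem_top

theorem mk_surjective : Function.Surjective (mk S a P) := Submodule.Quotient.mk_surjective _

theorem mk_smul (b : A ⊗[K] Aᵐᵒᵖ) (p : P) : mk S a P (b • p) = S.rightEval a b • mk S a P p :=
  (mk S a P).map_smulₛₗ b p

theorem smul_mk (r : A) (p : P) : r • mk S a P p = mk S a P ((r ⊗ₜ[K] (1 : Aᵐᵒᵖ)) • p) := rfl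

theorem mk_eq_zero (p : P) :
    mk S a P p = 0 ↔ p ∈ (RingHom.ker (S.rightEval a) • ⊤ : Submodule (A ⊗[K] Aᵐᵒᵖ) P) :=
  Submodule.Quotient.mk_eq_zero _

/-- Maps out of the fibre. -/
def lift {Z : Type*} [AddCommGroup Z] [Module A Z]
    (g : P →ₛₗ[(S.rightEval a : A ⊗[K] Aᵐᵒᵖ →+* A)] Z) : S.Fiber a P →ₗ[A] Z where
  toFun := QuotientAddGroup.lift _ g.toAddMonoidHom (by
    intro p hp
    change p ∈ (RingHom.ker (S.rightEval a) • ⊤ : Submodule (A ⊗[K] Aᵐᵒᵖ) P) at hp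
    change g p = 0
    induction hp using Submodule.smul_induction_on' with
    | smul b hb p _ =>
      rw [map_smulₛₗ]
      change S.rightEval a b • g p = 0
      rw [RingHom.mem_ker.1 hb, zero_smul]
    | add x _ y _ hx hy => rw [map_add, hx, hy, add_zero])
  map_add' := map_add _
  map_smul' r x := by
    obtain ⟨p, rfl⟩ := mk_surjective x
    rw [smul_mk]
    change g _ = r • g p
    rw [map_smulₛₗ]
    change S.rightEval a (r ⊗ₜ 1) • g p = r • g p
    rw [rightEval_tmul]
    simp

variable (S a) in
/-- The map on fibres induced by a bimodule map. -/
def map (g : P →ₗ[A ⊗[K] Aᵐᵒᵖ] Q) : S.Fiber a P →ₗ[A] S.Fiber a Q := lift ((mk S a Q).comp g)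

theorem map_mk (g : P →ₗ[A ⊗[K] Aᵐᵒᵖ] Q) (p : P) : map S a g (mk S a P p) = mk S a Q (g p) := rfl

instance [Module.Finite (A ⊗[K] Aᵐᵒᵖ) P] : Module.Finite A (S.Fiber a P) :=
  Module.Finite.of_surjective (mk S a P) mk_surjective

/-- The fibre is an extension of scalars along `rightEval a`: a lifting problem for it becomes one
for `P` once `A`-modules are viewed as bimodules through `rightEval a`. -/
theorem projective [Module.Projective (A ⊗[K] Aᵐᵒᵖ) P] : Module.Projective A (S.Fiber a P) := by
  refine Module.Projective.of_lifting_property'' fun f hf => ?_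
  let _ : Module (A ⊗[K] Aᵐᵒᵖ) (S.Fiber a P →₀ A) :=
    Module.compHom _ (S.rightEval a : A ⊗[K] Aᵐᵒᵖ →+* A)
  let _ : Module (A ⊗[K] Aᵐᵒᵖ) (S.Fiber a P) :=
    Module.compHom _ (S.rightEval a : A ⊗[K] Aᵐᵒᵖ →+* A)
  let f' : (S.Fiber a P →₀ A) →ₗ[A ⊗[K] Aᵐᵒᵖ] S.Fiber a P :=
    { toFun := f
      map_add' := map_add f
      map_smul' := fun b x => f.map_smul (S.rightEval a b) x }
  let q : P →ₗ[A ⊗[K] Aᵐᵒᵖ] S.Fiber a P :=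
    { toFun := mk S a P
      map_add' := map_add _
      map_smul' := fun b x => mk_smul b x }
  obtain ⟨h, hh⟩ := Module.projective_lifting_property f' q hf
  let h' : P →ₛₗ[(S.rightEval a : A ⊗[K] Aᵐᵒᵖ →+* A)] (S.Fiber a P →₀ A) :=
    { toFun := h
      map_add' := map_add h
      map_smul' := fun b x => h.map_smul b x }
  refine ⟨lift h', ?_⟩
  ext x
  obtain ⟨p, rfl⟩ := mk_surjective x
  exact LinearMap.congr_fun hh p

end Fiber

end SplitIdempotents

/-! ### Bimodules that are projective on the right -/

section RightRestrict

variable {K A : Type*} [Field K] [Ring A] [Algebra K A]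

variable (K A) in
/-- A bimodule regarded as a right module. -/
def RightRestrict (P : Type*) [AddCommGroup P] [Module (A ⊗[K] Aᵐᵒᵖ) P] : Type _ := P

variable {P Q L N : Type*} [AddCommGroup P] [Module (A ⊗[K] Aᵐᵒᵖ) P]
  [AddCommGroup Q] [Module (A ⊗[K] Aᵐᵒᵖ) Q] [AddCommGroup L] [Module (A ⊗[K] Aᵐᵒᵖ) L]
  [AddCommGroup N] [Module (A ⊗[K] Aᵐᵒᵖ) N]

namespace RightRestrict

instance : AddCommGroup (RightRestrict K A P) := inferInstanceAs (AddCommGroup P)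

instance : Module Aᵐᵒᵖ (RightRestrict K A P) :=
  Module.compHom P (Algebra.TensorProduct.includeRight : Aᵐᵒᵖ →ₐ[K] A ⊗[K] Aᵐᵒᵖ).toRingHom

/-- A bimodule map regarded as a map of right modules. -/
def map (g : P →ₗ[A ⊗[K] Aᵐᵒᵖ] Q) : RightRestrict K A P →ₗ[Aᵐᵒᵖ] RightRestrict K A Q where
  toFun := g
  map_add' := map_add g
  map_smul' z p := g.map_smul ((1 : A) ⊗ₜ[K] z) p

/-- Over the right-hand factor this is the base change of the vector space `A`. -/
theorem free_enveloping : Module.Free Aᵐᵒᵖ (RightRestrict K A (A ⊗[K] Aᵐᵒᵖ)) := by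
  let c := TensorProduct.comm K Aᵐᵒᵖ A
  have hc : ∀ (z : Aᵐᵒᵖ) (t : Aᵐᵒᵖ ⊗[K] A), c (z • t) = ((1 : A) ⊗ₜ[K] z) * c t := by
    intro z t
    induction t using TensorProduct.induction_on with
    | zero => rw [smul_zero, map_zero, mul_zero]
    | add x y hx hy => rw [smul_add, map_add, hx, hy, map_add, mul_add]
    | tmul y x =>
      simp [c, TensorProduct.smul_tmul', Algebra.TensorProduct.tmul_mul_tmul]
  let e : Aᵐᵒᵖ ⊗[K] A ≃ₗ[Aᵐᵒᵖ] RightRestrict K A (A ⊗[K] Aᵐᵒᵖ) :=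
    { toFun := c
      invFun := c.symm
      map_add' := map_add c
      map_smul' := hc
      left_inv := c.left_inv
      right_inv := c.right_inv }
  exact Module.Free.of_equiv e

theorem projective [Module.Projective (A ⊗[K] Aᵐᵒᵖ) P] :
    Module.Projective Aᵐᵒᵖ (RightRestrict K A P) := by
  have := free_enveloping (K := K) (A := A)
  have h : Module.Projective Aᵐᵒᵖ (RightRestrict K A (P →₀ A ⊗[K] Aᵐᵒᵖ)) := by
    refine Module.Projective.of_equiv' (M := P →₀ RightRestrict K A (A ⊗[K] Aᵐᵒᵖ))
      { toFun := fun x => x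
        invFun := fun x => x
        map_add' := fun _ _ => rfl
        map_smul' := fun _ _ => ?_
        left_inv := fun _ => rfl
        right_inv := fun _ => rfl }
    exact Finsupp.ext fun _ => rfl
  obtain ⟨s, hs⟩ := Module.projective_lifting_property
    (Finsupp.linearCombination (A ⊗[K] Aᵐᵒᵖ) (id : P → P)) LinearMap.id
    (Finsupp.linearCombination_id_surjective _ _)
  refine Module.Projective.of_split (map s)
    (map (P := P →₀ A ⊗[K] Aᵐᵒᵖ) (Finsupp.linearCombination (A ⊗[K] Aᵐᵒᵖ) (id : P → P))) ?_
  ext x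
  exact LinearMap.congr_fun hs x

end RightRestrict

namespace SplitIdempotents

variable {ι : Type*} [Fintype ι] [DecidableEq ι] (S : SplitIdempotents K A ι)

/-- A retraction of right modules suffices, although it need not respect the left action: it still
carries `I • ⊤` in `P` into `I • ⊤` in `N`. -/
theorem Fiber.map_injective {a : ι} {f : N →ₗ[A ⊗[K] Aᵐᵒᵖ] P}
    {ρ : RightRestrict K A P →ₗ[Aᵐᵒᵖ] RightRestrict K A N}
    (hρ : ρ ∘ₗ RightRestrict.map f = LinearMap.id) : Function.Injective (Fiber.map S a f) := by
  let I := RingHom.ker (S.rightEval a)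
  let ρ' : P →+ N := ρ.toAddMonoidHom
  have hρ' : ∀ n, ρ' (f n) = n := fun n => LinearMap.congr_fun hρ n
  have hr : ∀ (z : Aᵐᵒᵖ) p, ρ' (((1 : A) ⊗ₜ[K] z) • p) = ((1 : A) ⊗ₜ[K] z) • ρ' p :=
    fun z p => ρ.map_smul z p
  -- The difference is a sum of products (1 ⊗ z')(y ⊗ 1) with z' in the kernel of `χ a`, and the
  -- retraction commutes with 1 ⊗ z'. For `b` in the kernel of `rightEval a` the difference is `b`
  -- itself.
  have key : ∀ (b : A ⊗[K] Aᵐᵒᵖ) (p : P),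
      ρ' ((b - S.rightEval a b ⊗ₜ 1) • p) ∈ (I • ⊤ : Submodule (A ⊗[K] Aᵐᵒᵖ) N) := by
    intro b p
    induction b using TensorProduct.induction_on with
    | zero =>
      rw [map_zero, TensorProduct.zero_tmul, sub_zero]
      have h0 : ρ' ((0 : A ⊗[K] Aᵐᵒᵖ) • p) = 0 :=
        (congrArg ρ' (zero_smul (A ⊗[K] Aᵐᵒᵖ) p)).trans (map_zero ρ')
      exact (congrArg (· ∈ (I • ⊤ : Submodule (A ⊗[K] Aᵐᵒᵖ) N)) h0).mpr (zero_mem _)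
    | add x y hx hy =>
      have : x + y - S.rightEval a (x + y) ⊗ₜ[K] (1 : Aᵐᵒᵖ) =
          (x - S.rightEval a x ⊗ₜ 1) + (y - S.rightEval a y ⊗ₜ 1) := by
        rw [map_add, TensorProduct.add_tmul]
        abel
      rw [this, add_smul, map_add]
      exact add_mem hx hy
    | tmul y z =>
      let z' : Aᵐᵒᵖ := z - algebraMap K Aᵐᵒᵖ (S.χ a z.unop)
      have : y ⊗ₜ[K] z - S.rightEval a (y ⊗ₜ z) ⊗ₜ[K] (1 : Aᵐᵒᵖ) =
          ((1 : A) ⊗ₜ[K] z') * (y ⊗ₜ[K] (1 : Aᵐᵒᵖ)) := by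
        rw [rightEval_tmul, Algebra.TensorProduct.tmul_mul_tmul, one_mul, mul_one,
          TensorProduct.tmul_sub, Algebra.algebraMap_eq_smul_one, TensorProduct.smul_tmul]
      rw [this, mul_smul, hr]
      refine Submodule.smul_mem_smul ?_ Submodule.mem_top
      rw [RingHom.mem_ker, rightEval_tmul]
      simp [z', MulOpposite.algebraMap_apply]
  refine (injective_iff_map_eq_zero _).2 fun x hx => ?_
  obtain ⟨n, rfl⟩ := Fiber.mk_surjective x
  rw [Fiber.map_mk, Fiber.mk_eq_zero] at hx
  rw [Fiber.mk_eq_zero, ← hρ' n]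
  generalize f n = p at hx
  induction hx using Submodule.smul_induction_on' with
  | smul b hb p _ =>
    have := key b p
    rwa [RingHom.mem_ker.1 hb, TensorProduct.zero_tmul, sub_zero] at this
  | add x _ y _ hx hy => rw [map_add]; exact add_mem hx hy

/-- The fibres of a projective cover of a bimodule that is projective on the right. -/
theorem Fiber.isCoverSequence [FiniteDimensional K A] {f : N →ₗ[A ⊗[K] Aᵐᵒᵖ] P}
    {g : P →ₗ[A ⊗[K] Aᵐᵒᵖ] L} (hf : Function.Injective f) (hfg : Function.Exact f g)
    (hg : Function.Surjective g) [Module.Projective (A ⊗[K] Aᵐᵒᵖ) P]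
    (hker : ∀ N' : Submodule (A ⊗[K] Aᵐᵒᵖ) P, N' ⊔ LinearMap.ker g = ⊤ → N' = ⊤)
    [Module.Finite (A ⊗[K] Aᵐᵒᵖ) L] [Module.Projective Aᵐᵒᵖ (RightRestrict K A L)] :
    Module.Finite (A ⊗[K] Aᵐᵒᵖ) N ∧ Module.Projective Aᵐᵒᵖ (RightRestrict K A N) ∧
      ∀ a, S.IsCoverSequence (Fiber.map S a f) (Fiber.map S a g) := by
  have hP : Module.Finite (A ⊗[K] Aᵐᵒᵖ) P := by
    obtain ⟨n, s, hs⟩ := Module.Finite.exists_fin (R := A ⊗[K] Aᵐᵒᵖ) (M := L)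
    choose t ht using fun i => hg (s i)
    -- Lifts of generators of `L` generate `P`, the kernel being superfluous.
    have h1 : Submodule.span (A ⊗[K] Aᵐᵒᵖ) (Set.range t) = ⊤ := by
      apply hker
      rw [← Submodule.comap_map_eq, Submodule.map_span, ← Set.range_comp]
      have : g ∘ t = s := funext ht
      rw [this, hs, Submodule.comap_top]
    exact ⟨⟨(Set.finite_range t).toFinset, by simpa using h1⟩⟩
  have hnoeth : IsNoetherianRing (A ⊗[K] Aᵐᵒᵖ) := IsNoetherianRing.of_finite K _
  have hexR : Function.Exact (RightRestrict.map f) (RightRestrict.map g) := hfg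
  -- Right projectivity of `L` splits the sequence on the right, so `N` is again right projective
  -- and the argument can be iterated along the resolution.
  obtain ⟨σ, hσ⟩ := Module.projective_lifting_property (RightRestrict.map g) LinearMap.id hg
  have hsplit := hexR.split_tfae'.out 0 1
  obtain ⟨-, ρ, hρ⟩ := hsplit.1 ⟨hf, σ, hσ⟩
  have hPR : Module.Projective Aᵐᵒᵖ (RightRestrict K A P) := RightRestrict.projective
  refine ⟨Module.Finite.of_injective f hf, Module.Projective.of_split _ ρ hρ, fun a => ?_⟩
  refine ⟨Fiber.map_injective S hρ, ?_, ?_, Fiber.projective, inferInstance, ?_⟩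
  · intro x
    obtain ⟨p, rfl⟩ := Fiber.mk_surjective x
    constructor
    · intro h
      rw [Fiber.map_mk, Fiber.mk_eq_zero, ← LinearMap.range_eq_top.2 hg, ← Submodule.map_top,
        ← Submodule.map_smul''] at h
      obtain ⟨p', hp', hpp'⟩ := h
      obtain ⟨n, hn⟩ := (hfg (p - p')).1 (by rw [map_sub, hpp', sub_self])
      refine ⟨Fiber.mk S a N n, ?_⟩
      rw [Fiber.map_mk, hn, map_sub, (Fiber.mk_eq_zero p').2 hp', sub_zero]
    · rintro ⟨y, hy⟩
      obtain ⟨n, rfl⟩ := Fiber.mk_surjective y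
      rw [← hy, Fiber.map_mk, Fiber.map_mk, hfg.apply_apply_eq_zero, map_zero]
  · intro x
    obtain ⟨l, rfl⟩ := Fiber.mk_surjective x
    obtain ⟨p, rfl⟩ := hg l
    exact ⟨Fiber.mk S a P p, rfl⟩
  · intro x
    obtain ⟨n, rfl⟩ := Fiber.mk_surjective x
    have h1 : f n ∈ (S.enveloping.rad • ⊤ : Submodule (A ⊗[K] Aᵐᵒᵖ) P) :=
      S.enveloping.superfluous_le_rad_smul_top hker (hfg.apply_apply_eq_zero n)
    rw [Fiber.map_mk]
    generalize f n = p at h1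
    induction h1 using Submodule.smul_induction_on' with
    | smul b hb p _ =>
      rw [Fiber.mk_smul]
      exact Submodule.smul_mem_smul (S.rightEval_mem_rad a hb) Submodule.mem_top
    | add x _ y _ hx hy => rw [map_add]; exact add_mem hx hy

end SplitIdempotents

end RightRestrict

/-! ### Algebras of period four -/

namespace SplitIdempotents

section Regular

variable {K : Type w} {A : Type u} [Field K] [Ring A] [Algebra K A]

variable (K A) in
/-- The elements of the regular bimodule. -/
def toRegular : A ≃+ regularBimodule K A where
  toFun x := x
  invFun x := x
  left_inv _ := rfl
  right_inv _ := rfl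
  map_add' _ _ := rfl

theorem tmul_smul_toRegular (y : A) (z : Aᵐᵒᵖ) (x : A) :
    (y ⊗ₜ[K] z : A ⊗[K] Aᵐᵒᵖ) • toRegular K A x = toRegular K A (y * x * z.unop) := by
  let _ : Module (A ⊗[K] Aᵐᵒᵖ) A := instModuleTensorProductMop K A
  have h : (y ⊗ₜ[K] z : A ⊗[K] Aᵐᵒᵖ) • x = y * x * z.unop := by
    rw [TensorProduct.Algebra.smul_def, smul_eq_mul, MulOpposite.smul_eq_mul_unop, mul_assoc]
  exact h

theorem finite_regularBimodule : Module.Finite (A ⊗[K] Aᵐᵒᵖ) (regularBimodule K A) := by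
  refine ⟨⟨{toRegular K A 1}, ?_⟩⟩
  rw [eq_top_iff]
  intro x _
  obtain ⟨x, rfl⟩ := (toRegular K A).surjective x
  rw [Finset.coe_singleton, Submodule.mem_span_singleton]
  exact ⟨x ⊗ₜ 1, by rw [tmul_smul_toRegular, MulOpposite.unop_one, mul_one, mul_one]⟩

theorem projective_regularBimodule :
    Module.Projective Aᵐᵒᵖ (RightRestrict K A (regularBimodule K A)) := by
  let e : Aᵐᵒᵖ ≃ₗ[Aᵐᵒᵖ] RightRestrict K A (regularBimodule K A) :=
    { toFun := fun z => toRegular K A z.unop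
      invFun := fun x => MulOpposite.op ((toRegular K A).symm x)
      map_add' := fun _ _ => rfl
      map_smul' := fun z x => by
        refine Eq.trans ?_ (tmul_smul_toRegular (K := K) 1 z x.unop).symm
        rw [one_mul]
        rfl
      left_inv := fun _ => rfl
      right_inv := fun _ => rfl }
  exact Module.Projective.of_equiv' e

variable {ι : Type*} [Fintype ι] [DecidableEq ι] (S : SplitIdempotents K A ι)

theorem χ_smul_toRegular (a : ι) (b : A ⊗[K] Aᵐᵒᵖ) (x : A) :
    S.χ a ((toRegular K A).symm (b • toRegular K A x)) = S.enveloping.χ (a, a) b * S.χ a x := by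
  let F : A ⊗[K] Aᵐᵒᵖ →+ K := ((S.χ a : A →+ K).comp (toRegular K A).symm.toAddMonoidHom).comp
    ((smulAddHom (A ⊗[K] Aᵐᵒᵖ) (regularBimodule K A)).flip (toRegular K A x))
  let G : A ⊗[K] Aᵐᵒᵖ →+ K := (AddMonoidHom.mulRight (S.χ a x)).comp
    (S.enveloping.χ (a, a) : A ⊗[K] Aᵐᵒᵖ →+ K)
  change F b = G b
  induction b using TensorProduct.induction_on with
  | zero => exact (map_zero F).trans (map_zero G).symm
  | add b b' h h' => rw [map_add, h, h', map_add]
  | tmul y z =>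
    change S.χ a ((toRegular K A).symm (y ⊗ₜ[K] z • toRegular K A x)) =
      S.enveloping.χ (a, a) (y ⊗ₜ z) * S.χ a x
    rw [tmul_smul_toRegular, AddEquiv.symm_apply_apply, map_mul, map_mul, enveloping_χ_tmul]
    ring

/-- The fibre of the regular bimodule is `A` modulo the kernel of `χ a`: an `x` in that kernel is (1
⊗ op x) applied to 1, and 1 ⊗ op x is killed by `rightEval a`. -/
theorem isSimpleAt_fiber_regularBimodule (a : ι) :
    S.IsSimpleAt (S.Fiber a (regularBimodule K A)) a := by
  let q : A → S.Fiber a (regularBimodule K A) := fun x => Fiber.mk S a _ (toRegular K A x)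
  have hq : Function.Surjective q := Fiber.mk_surjective.comp (toRegular K A).surjective
  have hzero : ∀ x, q x = 0 ↔ S.χ a x = 0 := by
    intro x
    rw [Fiber.mk_eq_zero]
    constructor
    · intro hx
      suffices h : ∀ y ∈ (RingHom.ker (S.rightEval a) • ⊤ :
          Submodule (A ⊗[K] Aᵐᵒᵖ) (regularBimodule K A)), S.χ a ((toRegular K A).symm y) = 0 by
        simpa using h _ hx
      intro y hy
      induction hy using Submodule.smul_induction_on' with
      | smul b hb x _ =>
        obtain ⟨x, rfl⟩ := (toRegular K A).surjective x
        rw [χ_smul_toRegular, ← χ_rightEval, RingHom.mem_ker.1 hb, map_zero, zero_mul]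
      | add x _ y _ hx hy => rw [map_add, map_add, hx, hy, add_zero]
    · intro hx
      have h1 : toRegular K A x = ((1 : A) ⊗ₜ[K] MulOpposite.op x) • toRegular K A 1 := by
        rw [tmul_smul_toRegular, MulOpposite.unop_op, one_mul, one_mul]
      rw [h1]
      refine Submodule.smul_mem_smul ?_ Submodule.mem_top
      rw [RingHom.mem_ker, rightEval_tmul, MulOpposite.unop_op, hx, zero_smul]
  have hsmul : ∀ r x, r • q x = q (r * x) := by
    intro r x
    simp only [q]
    rw [Fiber.smul_mk, tmul_smul_toRegular, MulOpposite.unop_one, mul_one]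
  have hsub : ∀ x y, S.χ a x = S.χ a y → q x = q y := by
    intro x y h
    rw [← sub_eq_zero] at h ⊢
    rw [← map_sub, ← hzero] at h
    simpa [q] using h
  constructor
  · rw [finrank_eq_one_iff']
    refine ⟨q 1, fun h => ?_, fun x => ?_⟩
    · rw [hzero, map_one] at h
      exact one_ne_zero h
    · obtain ⟨x, rfl⟩ := hq x
      refine ⟨S.χ a x, ?_⟩
      rw [← algebraMap_smul A, hsmul]
      apply hsub
      rw [mul_one, AlgHom.commutes]
      rfl
  · rw [eq_top_iff]
    intro x _ r
    obtain ⟨x, rfl⟩ := hq x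
    rw [← algebraMap_smul A (S.χ a r), hsmul, hsmul]
    apply hsub
    rw [map_mul, map_mul, AlgHom.commutes]
    rfl

theorem isCoverSequence_of_isSyzygy [FiniteDimensional K A] {L N : ModuleCat.{v} (A ⊗[K] Aᵐᵒᵖ)}
    (h : IsSyzygy L N) [Module.Finite (A ⊗[K] Aᵐᵒᵖ) L]
    [Module.Projective Aᵐᵒᵖ (RightRestrict K A L)] :
    Module.Finite (A ⊗[K] Aᵐᵒᵖ) N ∧ Module.Projective Aᵐᵒᵖ (RightRestrict K A N) ∧
      ∃ (P : ModuleCat.{v} (A ⊗[K] Aᵐᵒᵖ)) (f : N →ₗ[A ⊗[K] Aᵐᵒᵖ] P) (g : P →ₗ[A ⊗[K] Aᵐᵒᵖ] L),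
        ∀ a, S.IsCoverSequence (Fiber.map S a f) (Fiber.map S a g) := by
  obtain ⟨P, g, ⟨hP, hg, hker⟩, ⟨e⟩⟩ := h
  let f : N →ₗ[A ⊗[K] Aᵐᵒᵖ] P := Submodule.subtype _ ∘ₗ e.toLinearMap
  have hf : Function.Injective f := Subtype.val_injective.comp e.injective
  have hfg : Function.Exact f g := by
    intro p
    constructor
    · intro hp
      obtain ⟨n, hn⟩ := e.surjective ⟨p, hp⟩
      exact ⟨n, congrArg Subtype.val hn⟩
    · rintro ⟨n, rfl⟩
      exact (e n).2
  obtain ⟨h1, h2, h3⟩ := Fiber.isCoverSequence S hf hfg hg hker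
  exact ⟨h1, h2, P, f, g, h3⟩

theorem isSyzygy_of_equiv {R : Type*} [Ring R] {M N N' : ModuleCat.{v} R} (h : IsSyzygy M N)
    (e : N' ≃ₗ[R] N) : IsSyzygy M N' := by
  obtain ⟨P, π, hπ, ⟨e'⟩⟩ := h
  exact ⟨P, π, hπ, ⟨e.trans e'⟩⟩

/-- The Cartan identities for a symmetric algebra of period four. -/
theorem cartan_of_isPeriodicAlgebra [FiniteDimensional K A] (hJ : S.rad ≤ Ring.jacobson A)
    (hsymm : IsSymmetricKAlgebra K A) (hper : IsPeriodicAlgebra K A 4) (a d : ι) :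
    ∑ c, Module.finrank K (S.radForms c a) * Module.finrank K (S.wt (Ideal.span {S.e c}) d) =
      ∑ c, Module.finrank K (S.radForms a c) * Module.finrank K (S.wt (Ideal.span {S.e c}) d) ∧
    Module.finrank K (S.wt (Ideal.span {S.e a}) d) + Module.finrank K (S.radForms a d) ≤
      ∑ c, Module.finrank K (S.radForms c a) * Module.finrank K (S.wt (Ideal.span {S.e c}) d) +
        if a = d then 1 else 0 := by
  obtain ⟨B, h1, h2, h3⟩ := hsymm
  have hB : IsSymmetrizingForm B := ⟨h1, h2, h3⟩
  obtain ⟨L₁, s₀, L₂, s₁, L₃, s₂, L₄, s₃, ⟨e⟩⟩ := hper.1.2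
  -- With the regular bimodule itself as fourth syzygy, both ends of the resolution have fibre
  -- simple at `a`.
  have s₃' := isSyzygy_of_equiv s₃ e
  have := finite_regularBimodule (K := K) (A := A)
  have := projective_regularBimodule (K := K) (A := A)
  obtain ⟨_, _, P₀, f₀, g₀, c₀⟩ := S.isCoverSequence_of_isSyzygy s₀
  obtain ⟨_, _, P₁, f₁, g₁, c₁⟩ := S.isCoverSequence_of_isSyzygy s₁
  obtain ⟨_, _, P₂, f₂, g₂, c₂⟩ := S.isCoverSequence_of_isSyzygy s₂
  obtain ⟨_, _, P₃, f₃, g₃, c₃⟩ := S.isCoverSequence_of_isSyzygy s₃'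
  exact S.cartan_of_period_four hB hJ (c₀ a) (c₁ a) (c₂ a) (c₃ a)
    (S.isSimpleAt_fiber_regularBimodule a) (S.isSimpleAt_fiber_regularBimodule a) d

end Regular

end SplitIdempotents

/-! ### Bound quiver algebras -/

noncomputable section

namespace PathAlgebra

variable {K : Type w} [Field K] {V : Type u} [Quiver.{v} V]

theorem ofPath_mem_arrowIdeal_pow (n : ℕ) {a b : V} (p : Quiver.Path a b) [Fintype V]
    (hp : n + 1 ≤ p.length) : ofPath p ∈ arrowIdeal K V ^ (n + 1) := by
  induction n generalizing b with
  | zero =>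
    rw [zero_add, pow_one]
    exact Submodule.subset_span ⟨a, b, p, by omega, rfl⟩
  | succ n ih =>
    cases p with
    | nil => simp at hp
    | cons q α =>
      rw [pow_succ]
      have h : (ofPath (q.cons α) : PathAlgebra K V) = ofPath q * ofPath α.toPath := by
        rw [ofPath_mul_comp]
        rfl
      rw [h]
      refine Submodule.mul_mem_mul (ih q ?_) (Submodule.subset_span ⟨_, _, _, ?_, rfl⟩)
      · rw [Quiver.Path.length_cons] at hp
        omega
      · simp

variable [Fintype V]

theorem arrowIdeal_sq_le {W : Submodule K (PathAlgebra K V)}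
    (hW : ∀ (a b : V) (p : Quiver.Path a b), 2 ≤ p.length → ofPath p ∈ W) :
    arrowIdeal K V ^ 2 ≤ W := by
  rw [pow_two, arrowIdeal, Submodule.span_mul_span, Submodule.span_le]
  rintro _ ⟨_, ⟨a, b, p, hp, rfl⟩, _, ⟨c, d, q, hq, rfl⟩, rfl⟩
  simp only [SetLike.mem_coe]
  by_cases h : c = b
  · subst h
    rw [ofPath_mul_comp]
    refine hW _ _ _ ?_
    rw [Quiver.Path.length_comp]
    omega
  · rw [ofPath_mul_of_ne _ _ h]
    exact W.zero_mem

open Classical in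
/-- The coefficient of the trivial path at a vertex, as a linear map. -/
def vertexCoeff (a : V) : PathAlgebra K V →ₗ[K] K :=
  (pathBasis K V).constr K fun p => if p.2.2.length = 0 ∧ p.1 = a then 1 else 0

open Classical in
theorem vertexCoeff_ofPath (a : V) {x y : V} (p : Quiver.Path x y) :
    vertexCoeff a (ofPath p : PathAlgebra K V) = if p.length = 0 ∧ x = a then 1 else 0 := by
  rw [vertexCoeff, ofPath, Module.Basis.constr_basis]

theorem vertexCoeff_of_length_ne_zero (a : V) {x y : V} {p : Quiver.Path x y}
    (hp : p.length ≠ 0) : vertexCoeff a (ofPath p : PathAlgebra K V) = 0 := by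
  classical
  rw [vertexCoeff_ofPath, if_neg (fun h => hp h.1)]

theorem vertexCoeff_nil [DecidableEq V] (a b : V) :
    vertexCoeff a (ofPath (Quiver.Path.nil : Quiver.Path b b) : PathAlgebra K V) =
      if a = b then 1 else 0 := by
  rw [vertexCoeff_ofPath]
  simp [eq_comm]

theorem vertexCoeff_mul (a : V) (f g : PathAlgebra K V) :
    vertexCoeff a (f * g) = vertexCoeff a f * vertexCoeff a g := by
  classical
  induction f using induction_ofPath with
  | h0 => simp
  | hadd f₁ f₂ h₁ h₂ => rw [add_mul, map_add, map_add, h₁, h₂, add_mul]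
  | hsmul c x y p =>
  induction g using induction_ofPath with
  | h0 => simp
  | hadd f₁ f₂ h₁ h₂ => rw [mul_add, map_add, map_add, h₁, h₂, mul_add]
  | hsmul c' z t q =>
  rw [smul_mul_smul_comm, map_smul, map_smul, map_smul]
  suffices h : vertexCoeff a (ofPath p * ofPath q : PathAlgebra K V) =
      vertexCoeff a (ofPath p : PathAlgebra K V) * vertexCoeff a (ofPath q : PathAlgebra K V) by
    rw [h]
    simp only [smul_eq_mul]
    ring
  by_cases hz : z = y
  · subst hz
    rw [ofPath_mul_comp, vertexCoeff_ofPath, vertexCoeff_ofPath, vertexCoeff_ofPath,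
      Quiver.Path.length_comp]
    by_cases hp : p.length = 0
    · obtain rfl := Quiver.Path.eq_of_length_zero p hp
      simp only [hp, zero_add, true_and]
      split_ifs <;> simp_all
    · rw [if_neg (by omega), if_neg (by omega), zero_mul]
  · rw [ofPath_mul_of_ne _ _ hz, map_zero, vertexCoeff_ofPath, vertexCoeff_ofPath]
    by_cases hp : p.length = 0 ∧ x = a
    · rw [if_neg (c := q.length = 0 ∧ z = a), mul_zero]
      rintro ⟨-, h⟩
      exact hz (h.trans (hp.2.symm.trans (Quiver.Path.eq_of_length_zero p hp.1)))
    · rw [if_neg hp, zero_mul]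

/-- The character of the path algebra at a vertex. -/
def vertexChar (a : V) : PathAlgebra K V →ₐ[K] K :=
  AlgHom.ofLinearMap (vertexCoeff a) (by
    classical
    rw [one_def, map_sum]
    simp [vertexCoeff_nil]) (vertexCoeff_mul a)

theorem vertexCoeff_of_mem_arrowIdeal (a : V) {f : PathAlgebra K V} (hf : f ∈ arrowIdeal K V) :
    vertexCoeff a f = 0 := by
  refine (Submodule.span_le (p := LinearMap.ker (vertexCoeff a))).2 ?_ hf
  rintro _ ⟨x, y, p, hp, rfl⟩
  exact vertexCoeff_of_length_ne_zero a (by omega)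

theorem sub_sum_mem_arrowIdeal (f : PathAlgebra K V) :
    f - ∑ a, vertexCoeff a f • ofPath (Quiver.Path.nil : Quiver.Path a a) ∈ arrowIdeal K V := by
  classical
  induction f using induction_ofPath with
  | h0 => simp
  | hadd f g hf hg =>
    simp only [map_add, add_smul, Finset.sum_add_distrib]
    rw [add_sub_add_comm]
    exact add_mem hf hg
  | hsmul c x y p =>
    by_cases hp : p.length = 0
    · obtain rfl := Quiver.Path.eq_of_length_zero p hp
      rw [Quiver.Path.eq_nil_of_length_zero p hp]
      simp [vertexCoeff_nil]
    · simp only [map_smul, vertexCoeff_of_length_ne_zero _ hp, smul_zero, zero_smul,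
        Finset.sum_const_zero, sub_zero]
      exact Submodule.smul_mem _ _ (Submodule.subset_span ⟨x, y, p, by omega, rfl⟩)

theorem mem_arrowIdeal_iff {f : PathAlgebra K V} :
    f ∈ arrowIdeal K V ↔ ∀ a, vertexCoeff a f = 0 := by
  refine ⟨fun h a => vertexCoeff_of_mem_arrowIdeal a h, fun h => ?_⟩
  simpa [h] using sub_sum_mem_arrowIdeal f

theorem mul_mem_arrowIdeal_left (f : PathAlgebra K V) {g : PathAlgebra K V}
    (hg : g ∈ arrowIdeal K V) : f * g ∈ arrowIdeal K V := by
  rw [mem_arrowIdeal_iff] at *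
  intro a
  rw [vertexCoeff_mul, hg, mul_zero]

section ArrowForm

variable {c a : V} (v : (c ⟶ a) → K)

open Classical in
/-- The functional that takes given values on the arrows from `c` to `a` and vanishes on all
other paths. -/
def arrowForm : PathAlgebra K V →ₗ[K] K :=
  (pathBasis K V).constr K fun p =>
    if h : ∃ α : c ⟶ a, p = ⟨c, a, α.toPath⟩ then v h.choose else 0

theorem arrowForm_toPath (α : c ⟶ a) : arrowForm v (ofPath α.toPath) = v α := by
  have h : ∃ α' : c ⟶ a, (⟨c, a, α.toPath⟩ : AllPaths V) = ⟨c, a, α'.toPath⟩ := ⟨α, rfl⟩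
  rw [arrowForm, ofPath, Module.Basis.constr_basis, dif_pos h]
  have h1 := h.choose_spec
  generalize h.choose = α' at h1
  simp only [Sigma.mk.injEq, heq_eq_eq, true_and] at h1
  rw [Quiver.Hom.toPath, Quiver.Hom.toPath] at h1
  injection h1 with _ _ _ h2
  rw [h2]

theorem arrowForm_eq_zero {x y : V} (p : Quiver.Path x y)
    (h : p.length ≠ 1 ∨ x ≠ c ∨ y ≠ a) : arrowForm v (ofPath p) = 0 := by
  rw [arrowForm, ofPath, Module.Basis.constr_basis, dif_neg]
  rintro ⟨α, hα⟩
  have h1 : x = c := congrArg Sigma.fst hα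
  have h2 : y = a := congrArg (fun p : AllPaths V => p.2.1) hα
  have h3 : p.length = 1 := congrArg (fun p : AllPaths V => p.2.2.length) hα
  simp_all

/-- An arrow is not a product of two paths of positive length, so only the trivial path at `c` in
`r` contributes. -/
theorem arrowForm_mul_left (r : PathAlgebra K V) {f : PathAlgebra K V}
    (hf : f ∈ arrowIdeal K V) : arrowForm v (r * f) = vertexCoeff c r * arrowForm v f := by
  classical
  induction hf using Submodule.span_induction with
  | zero => simp
  | add f g _ _ hf hg => rw [mul_add, map_add, map_add, hf, hg, mul_add]
  | smul k f _ hf =>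
    rw [mul_smul_comm, map_smul, map_smul, hf, smul_eq_mul, smul_eq_mul]
    ring
  | mem f hf =>
  obtain ⟨x, y, p, hp, rfl⟩ := hf
  induction r using induction_ofPath with
  | h0 => simp
  | hadd f g hf hg => rw [add_mul, map_add, map_add, hf, hg, add_mul]
  | hsmul k z t q =>
  rw [smul_mul_assoc, map_smul, map_smul, smul_eq_mul, smul_eq_mul, mul_assoc]
  congr 1
  by_cases hq : q.length = 0
  · obtain rfl := Quiver.Path.eq_of_length_zero q hq
    rw [Quiver.Path.eq_nil_of_length_zero q hq, vertexCoeff_nil]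
    by_cases hx : x = z
    · subst hx
      rw [ofPath_mul_comp, Quiver.Path.nil_comp]
      split_ifs with h
      · rw [one_mul]
      · rw [zero_mul, arrowForm_eq_zero v p (Or.inr (Or.inl (Ne.symm h)))]
    · rw [ofPath_mul_of_ne _ _ hx, map_zero]
      split_ifs with h
      · subst h
        rw [arrowForm_eq_zero v p (Or.inr (Or.inl hx)), mul_zero]
      · rw [zero_mul]
  · rw [vertexCoeff_of_length_ne_zero _ hq, zero_mul]
    by_cases hx : x = t
    · subst hx
      rw [ofPath_mul_comp, arrowForm_eq_zero]
      left
      rw [Quiver.Path.length_comp]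
      omega
    · rw [ofPath_mul_of_ne _ _ hx, map_zero]

theorem arrowForm_mul_right (r : PathAlgebra K V) {f : PathAlgebra K V}
    (hf : f ∈ arrowIdeal K V) : arrowForm v (f * r) = arrowForm v f * vertexCoeff a r := by
  classical
  induction hf using Submodule.span_induction with
  | zero => simp
  | add f g _ _ hf hg => rw [add_mul, map_add, map_add, hf, hg, add_mul]
  | smul k f _ hf =>
    rw [smul_mul_assoc, map_smul, map_smul, hf, smul_eq_mul, smul_eq_mul]
    ring
  | mem f hf =>
  obtain ⟨x, y, p, hp, rfl⟩ := hf
  induction r using induction_ofPath with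
  | h0 => simp
  | hadd f g hf hg => rw [mul_add, map_add, map_add, hf, hg, mul_add]
  | hsmul k z t q =>
  rw [mul_smul_comm, map_smul, map_smul, smul_eq_mul, smul_eq_mul, mul_left_comm]
  congr 1
  by_cases hq : q.length = 0
  · obtain rfl := Quiver.Path.eq_of_length_zero q hq
    rw [Quiver.Path.eq_nil_of_length_zero q hq, vertexCoeff_nil]
    by_cases hx : z = y
    · subst hx
      rw [ofPath_mul_comp, Quiver.Path.comp_nil]
      split_ifs with h
      · rw [mul_one]
      · rw [mul_zero, arrowForm_eq_zero v p (Or.inr (Or.inr (Ne.symm h)))]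
    · rw [ofPath_mul_of_ne _ _ hx, map_zero]
      split_ifs with h
      · subst h
        rw [arrowForm_eq_zero v p (Or.inr (Or.inr (Ne.symm hx))), zero_mul]
      · rw [mul_zero]
  · rw [vertexCoeff_of_length_ne_zero _ hq, mul_zero]
    by_cases hx : z = y
    · subst hx
      rw [ofPath_mul_comp, arrowForm_eq_zero]
      left
      rw [Quiver.Path.length_comp]
      omega
    · rw [ofPath_mul_of_ne _ _ hx, map_zero]

end ArrowForm

end PathAlgebra

end

/-! ### Idempotents, radical and arrows of a bound quiver algebra. -/

noncomputable section

theorem Ring.le_jacobson_of_isNilpotent {R : Type*} [Ring R] {J : Ideal R}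
    (hJ : ∀ r ∈ J, IsNilpotent r) : J ≤ Ring.jacobson R := by
  intro r hr
  rw [← Ideal.jacobson_bot, Ideal.mem_jacobson_iff]
  intro y
  obtain ⟨z, hz⟩ := (hJ _ (J.mul_mem_left y hr)).isUnit_one_add
  refine ⟨(z⁻¹ : Rˣ), ?_⟩
  have h : ((z⁻¹ : Rˣ) : R) * (1 + y * r) = 1 := by rw [← hz, Units.inv_mul]
  rw [mul_add, mul_one, ← mul_assoc] at h
  rw [Ideal.mem_bot, ← h]
  abel

instance Quiver.Path.finite_length_eq {V : Type u} [Quiver.{v} V] [Finite V]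
    [∀ a b : V, Finite (a ⟶ b)] (n : ℕ) (a b : V) :
    Finite {p : Quiver.Path a b // p.length = n} := by
  induction n generalizing b with
  | zero =>
    have : Subsingleton {p : Quiver.Path a b // p.length = 0} := by
      refine ⟨?_⟩
      rintro ⟨p, hp⟩ ⟨q, hq⟩
      obtain rfl := Quiver.Path.eq_of_length_zero p hp
      rw [Subtype.mk.injEq, Quiver.Path.eq_nil_of_length_zero p hp,
        Quiver.Path.eq_nil_of_length_zero q hq]
    infer_instance
  | succ n ih =>
    refine Finite.of_surjective
      (fun x : Σ c : V, {p : Quiver.Path a c // p.length = n} × (c ⟶ b) =>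
        (⟨x.2.1.1.cons x.2.2, by rw [Quiver.Path.length_cons, x.2.1.2]⟩ :
          {p : Quiver.Path a b // p.length = n + 1})) ?_
    rintro ⟨p, hp⟩
    cases p with
    | nil => simp at hp
    | @cons c _ q α => exact ⟨⟨c, ⟨q, by simpa using hp⟩, α⟩, rfl⟩

namespace PathAlgebra

variable {K : Type w} [Field K] {V : Type u} [Quiver.{v} V] [Fintype V]
  {I : Ideal (PathAlgebra K V)} [I.IsTwoSided]

theorem IsAdmissible.vertexCoeff_eq_zero (hI : IsAdmissible I) (a : V) {f : PathAlgebra K V}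
    (hf : f ∈ I) : vertexCoeff a f = 0 := by
  have h : arrowIdeal K V ^ 2 ≤ LinearMap.ker (vertexCoeff a) :=
    arrowIdeal_sq_le fun x y p hp => vertexCoeff_of_length_ne_zero a (by omega)
  exact h (hI.1 hf)

theorem IsAdmissible.arrowForm_eq_zero (hI : IsAdmissible I) {c a : V} (v : (c ⟶ a) → K)
    {f : PathAlgebra K V} (hf : f ∈ I) : arrowForm v f = 0 := by
  have h : arrowIdeal K V ^ 2 ≤ LinearMap.ker (arrowForm v) :=
    arrowIdeal_sq_le fun x y p hp => PathAlgebra.arrowForm_eq_zero v p (Or.inl (by omega))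
  exact h (hI.1 hf)

variable [DecidableEq V]

/-- The vertex idempotents of a bound quiver algebra. -/
def IsAdmissible.idempotents (hI : IsAdmissible I) :
    SplitIdempotents K (PathAlgebra K V ⧸ I) V where
  e a := Ideal.Quotient.mk I (ofPath (Quiver.Path.nil : Quiver.Path a a))
  χ a := Ideal.Quotient.liftₐ I (vertexChar a) fun _ hf => hI.vertexCoeff_eq_zero a hf
  χ_e a b := (vertexCoeff_nil a b : _)
  e_mul_e a b := by
    rw [← map_mul]
    split_ifs with h
    · subst h
      rw [ofPath_mul_comp, Quiver.Path.comp_nil]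
    · rw [ofPath_mul_of_ne _ _ (Ne.symm h), map_zero]
  sum_e := by rw [← map_sum, ← one_def, map_one]

variable (hI : IsAdmissible I)

theorem IsAdmissible.χ_mk (a : V) (f : PathAlgebra K V) :
    hI.idempotents.χ a (Ideal.Quotient.mk I f) = vertexCoeff a f := rfl

theorem IsAdmissible.e_def (a : V) : hI.idempotents.e a =
    Ideal.Quotient.mk I (ofPath (Quiver.Path.nil : Quiver.Path a a)) := rfl

theorem IsAdmissible.mk_mem_rad {f : PathAlgebra K V} :
    Ideal.Quotient.mk I f ∈ hI.idempotents.rad ↔ f ∈ arrowIdeal K V := by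
  rw [SplitIdempotents.mem_rad, mem_arrowIdeal_iff]
  rfl

theorem IsAdmissible.rad_le_jacobson :
    hI.idempotents.rad ≤ Ring.jacobson (PathAlgebra K V ⧸ I) := by
  refine Ring.le_jacobson_of_isNilpotent fun r hr => ?_
  obtain ⟨f, rfl⟩ := Ideal.Quotient.mk_surjective r
  obtain ⟨m, -, hm⟩ := hI.2
  refine ⟨m, ?_⟩
  rw [← map_pow, Ideal.Quotient.eq_zero_iff_mem]
  exact hm (Submodule.pow_mem_pow _ (hI.mk_mem_rad.1 hr) m)

omit [DecidableEq V] in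
include hI in
-- Paths of length less than `m` span the quotient, and there are finitely many of them.
theorem IsAdmissible.finiteDimensional [∀ a b : V, Finite (a ⟶ b)] :
    FiniteDimensional K (PathAlgebra K V ⧸ I) := by
  obtain ⟨m, hm2, hm⟩ := hI.2
  let T := Σ n : Fin m, Σ a b : V, {p : Quiver.Path a b // p.length = (n : ℕ)}
  let g : T → PathAlgebra K V ⧸ I := fun t => Ideal.Quotient.mk I (ofPath t.2.2.2.1)
  have hspan : Submodule.span K (Set.range g) = ⊤ := by
    rw [eq_top_iff]
    rintro r -
    obtain ⟨f, rfl⟩ := Ideal.Quotient.mk_surjective r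
    induction f using induction_ofPath with
    | h0 => rw [map_zero]; exact zero_mem _
    | hadd f g hf hg => rw [map_add]; exact add_mem hf hg
    | hsmul c a b p =>
      have h1 : Ideal.Quotient.mk I (c • ofPath p) =
          c • Ideal.Quotient.mk I (ofPath p : PathAlgebra K V) := rfl
      rw [h1]
      refine Submodule.smul_mem _ _ ?_
      by_cases hp : p.length < m
      · exact Submodule.subset_span ⟨⟨⟨p.length, hp⟩, a, b, p, rfl⟩, rfl⟩
      · obtain ⟨n, rfl⟩ : ∃ n, m = n + 1 := ⟨m - 1, by omega⟩
        rw [Ideal.Quotient.eq_zero_iff_mem.2 (hm (ofPath_mem_arrowIdeal_pow n p (by omega)))]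
        exact zero_mem _
  exact ⟨⟨(Set.finite_range g).toFinset, by simpa using hspan⟩⟩

theorem IsAdmissible.mk_ofPath_mem_rad {x y : V} {p : Quiver.Path x y} (hp : 1 ≤ p.length) :
    Ideal.Quotient.mk I (ofPath p) ∈ hI.idempotents.rad :=
  hI.mk_mem_rad.2 (Submodule.subset_span ⟨_, _, _, hp, rfl⟩)

theorem IsAdmissible.radForms_arrow {c a x y : V}
    {φ : (PathAlgebra K V ⧸ I) →ₗ[K] K} (hφ : φ ∈ hI.idempotents.radForms c a)
    (h : ∀ α : c ⟶ a, φ (Ideal.Quotient.mk I (ofPath α.toPath)) = 0) (α : x ⟶ y) :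
    φ (Ideal.Quotient.mk I (ofPath α.toPath)) = 0 := by
  have hα : Ideal.Quotient.mk I (ofPath α.toPath) ∈ hI.idempotents.rad :=
    hI.mk_ofPath_mem_rad (by simp)
  have h1 := hφ.2 _ hα (hI.idempotents.e x) (hI.idempotents.e y)
  have h2 : hI.idempotents.e x * Ideal.Quotient.mk I (ofPath α.toPath) *
      hI.idempotents.e y = Ideal.Quotient.mk I (ofPath α.toPath) := by
    rw [hI.e_def, hI.e_def, ← map_mul, ← map_mul, ofPath_mul_comp, ofPath_mul_comp,
      Quiver.Path.nil_comp, Quiver.Path.comp_nil]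
  rw [h2, SplitIdempotents.χ_e, SplitIdempotents.χ_e] at h1
  by_cases hx : c = x
  · by_cases hy : a = y
    · subst hx hy
      exact h α
    · rw [h1, if_neg hy, mul_zero]
  · rw [h1, if_neg hx, zero_mul, zero_mul]

theorem IsAdmissible.radForms_cons {c a x y z : V}
    {φ : (PathAlgebra K V ⧸ I) →ₗ[K] K} (hφ : φ ∈ hI.idempotents.radForms c a)
    {q : Quiver.Path x y} (hq : 1 ≤ q.length) (α : y ⟶ z) :
    φ (Ideal.Quotient.mk I (ofPath (q.cons α))) = 0 := by
  have h1 := hφ.2 _ (hI.mk_ofPath_mem_rad hq) 1 (Ideal.Quotient.mk I (ofPath α.toPath))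
  have h2 : (ofPath (q.cons α) : PathAlgebra K V) = ofPath q * ofPath α.toPath := by
    rw [ofPath_mul_comp]
    rfl
  rw [hI.χ_mk a (ofPath α.toPath), vertexCoeff_of_length_ne_zero _ (by simp), mul_zero,
    one_mul] at h1
  rw [h2, map_mul, h1]

theorem IsAdmissible.radForms_ext {c a : V}
    {φ : (PathAlgebra K V ⧸ I) →ₗ[K] K} (hφ : φ ∈ hI.idempotents.radForms c a)
    (h : ∀ α : c ⟶ a, φ (Ideal.Quotient.mk I (ofPath α.toPath)) = 0) : φ = 0 := by
  refine LinearMap.ext fun r => ?_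
  obtain ⟨f, rfl⟩ := Ideal.Quotient.mk_surjective r
  rw [LinearMap.zero_apply]
  induction f using induction_ofPath with
  | h0 => rw [map_zero, map_zero]
  | hadd f g hf hg => rw [map_add, map_add, hf, hg, add_zero]
  | hsmul k x y p =>
    have h1 : Ideal.Quotient.mk I (k • ofPath p) =
        k • Ideal.Quotient.mk I (ofPath p : PathAlgebra K V) := rfl
    rw [h1, map_smul]
    suffices h2 : φ (Ideal.Quotient.mk I (ofPath p)) = 0 by rw [h2, smul_zero]
    cases p with
    | nil => exact hφ.1 x
    | cons q α =>
      cases q with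
      | nil => exact hI.radForms_arrow hφ h α
      | cons q β => exact hI.radForms_cons hφ (by simp) α

/-- Forms are evaluated on arrows. They vanish on products of two radical elements, so these values
determine them; every choice of values occurs because I ⊆ R² lets the corresponding arrow form
descend to the quotient. -/
theorem IsAdmissible.finrank_radForms [∀ a b : V, Finite (a ⟶ b)] (c a : V) :
    Module.finrank K (hI.idempotents.radForms c a) = Nat.card (c ⟶ a) := by
  classical
  have := Fintype.ofFinite (c ⟶ a)
  rw [Nat.card_eq_fintype_card, ← Module.finrank_fintype_fun_eq_card K]
  let F : hI.idempotents.radForms c a →ₗ[K] ((c ⟶ a) → K) :=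
    { toFun := fun φ α => φ.1 (Ideal.Quotient.mk I (ofPath α.toPath))
      map_add' := fun _ _ => rfl
      map_smul' := fun _ _ => rfl }
  refine LinearEquiv.finrank_eq (LinearEquiv.ofBijective F ⟨?_, ?_⟩)
  · intro φ ψ h
    rw [← sub_eq_zero]
    refine Subtype.ext (hI.radForms_ext (φ - ψ).2 fun α => ?_)
    exact sub_eq_zero.2 (congrFun h α)
  · intro v
    let φ : (PathAlgebra K V ⧸ I) →ₗ[K] K :=
      (I.restrictScalars K).liftQ (arrowForm v) fun f hf => hI.arrowForm_eq_zero v hf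
    have hφ : ∀ f, φ (Ideal.Quotient.mk I f) = arrowForm v f := fun _ => rfl
    refine ⟨⟨φ, fun i => ?_, fun y hy r s => ?_⟩, funext fun α => ?_⟩
    · exact PathAlgebra.arrowForm_eq_zero v _ (Or.inl (by simp))
    · obtain ⟨y, rfl⟩ := Ideal.Quotient.mk_surjective y
      obtain ⟨r, rfl⟩ := Ideal.Quotient.mk_surjective r
      obtain ⟨s, rfl⟩ := Ideal.Quotient.mk_surjective s
      rw [hI.mk_mem_rad] at hy
      rw [← map_mul, ← map_mul, hφ, hφ, hI.χ_mk, hI.χ_mk,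
        arrowForm_mul_right v s (mul_mem_arrowIdeal_left r hy), arrowForm_mul_left v r hy]
    · exact arrowForm_toPath v α

end PathAlgebra

end

/-! ### Indecomposable modules over truncated polynomial rings. -/

open scoped DirectSum in
/-- An indecomposable module over a quotient ring of `K[X]` in which `X` is nilpotent is cyclic,
with annihilator generated by a power of `X`. -/
theorem IsIndecomposableModule.nonempty_equiv_quotient_span_pow {K : Type w} [Field K]
    {R : Type u} [Ring R] (f : K[X] →+* R) (hf : Function.Surjective f) (m : ℕ)
    (hm : f Polynomial.X ^ m = 0) (N : Type v) [AddCommGroup N] [Module R N] [Module.Finite R N]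
    (hN : IsIndecomposableModule R N) :
    ∃ k ≤ m, Nonempty (N ≃ₗ[R] R ⧸ Ideal.span {f Polynomial.X ^ k}) := by
  let : Module K[X] N := Module.compHom N f
  have hsmul (q : K[X]) (n : N) : q • n = f q • n := rfl
  have hfin : Module.Finite K[X] N := by
    let : Module K[X] R := Module.compHom R f
    have : IsScalarTower K[X] R N := ⟨fun q r n => mul_smul (f q) r n⟩
    have : Module.Finite K[X] R := Module.Finite.of_surjective
      ({ toFun := f, map_add' := map_add f, map_smul' := fun a b => map_mul f a b } :
        K[X] →ₗ[K[X]] R) hf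
    exact Module.Finite.trans R N
  have htors : Module.IsTorsion' N (Submonoid.powers (Polynomial.X : K[X])) := by
    intro n
    refine ⟨⟨Polynomial.X ^ m, m, rfl⟩, ?_⟩
    change (Polynomial.X ^ m : K[X]) • n = 0
    rw [hsmul, map_pow, hm, zero_smul]
  obtain ⟨d, k, ⟨e⟩⟩ := Module.torsion_by_prime_power_decomposition
    (R := K[X]) Polynomial.irreducible_X htors
  have := hN.1
  obtain ⟨n, hn⟩ := exists_ne (0 : N)
  obtain ⟨l, hl⟩ : ∃ l, e n l ≠ 0 := by
    by_contra! h
    exact hn (e.map_eq_zero_iff.mp (DFinsupp.ext h))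
  let r : N →ₗ[K[X]] (K[X] ⧸ K[X] ∙ (Polynomial.X ^ k l : K[X])) :=
    DirectSum.component K[X] _ _ l ∘ₗ e.toLinearMap
  let s : (K[X] ⧸ K[X] ∙ (Polynomial.X ^ k l : K[X])) →ₗ[K[X]] N :=
    e.symm.toLinearMap ∘ₗ
      DirectSum.lof K[X] _ (fun l => K[X] ⧸ K[X] ∙ (Polynomial.X ^ k l : K[X])) l
  have hrs (x) : r (s x) = x := by
    change e (e.symm (DirectSum.lof K[X] _ _ l x)) l = x
    rw [e.apply_symm_apply]
    exact DirectSum.lof_apply (M := fun l => K[X] ⧸ K[X] ∙ (Polynomial.X ^ k l : K[X])) K[X] l x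
  let π : N →ₗ[R] N :=
    { toFun := fun x => s (r x)
      map_add' := fun x y => by rw [map_add, map_add]
      map_smul' := fun a x => by
        obtain ⟨q, rfl⟩ := hf a
        rw [← hsmul, map_smul, map_smul]
        rfl }
  have hπ (x : N) : π x = s (r x) := rfl
  have hππ : IsIdempotentElem π := LinearMap.ext fun x => by
    rw [Module.End.mul_apply, hπ (π x), hπ x, hrs]
  have hker : LinearMap.ker π = ⊥ := by
    refine (hN.2 _ _ (LinearMap.IsIdempotentElem.isCompl hππ)).resolve_left fun h => hl ?_
    have h0 : π n = 0 := by
      rw [← Submodule.mem_bot R, ← h]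
      exact ⟨n, rfl⟩
    have := congrArg r h0
    rw [hπ, hrs, map_zero] at this
    exact this
  have hsr (x : N) : s (r x) = x := by
    have h : x - π x ∈ LinearMap.ker π := by
      rw [LinearMap.mem_ker, map_sub, sub_eq_zero, hπ (π x), hπ x, hrs]
    rw [hker, Submodule.mem_bot, sub_eq_zero] at h
    exact h.symm
  have hs (q : K[X]) : s (Submodule.Quotient.mk q) = q • s (Submodule.Quotient.mk 1) := by
    rw [← map_smul, ← Submodule.Quotient.mk_smul, smul_eq_mul, mul_one]
  have hs0 (q : K[X]) : s (Submodule.Quotient.mk q) = 0 ↔ Polynomial.X ^ k l ∣ q := by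
    rw [← Ideal.mem_span_singleton, ← Ideal.submodule_span_eq, ← Submodule.Quotient.mk_eq_zero]
    refine ⟨fun h => ?_, fun h => by rw [h, map_zero]⟩
    rw [← hrs (Submodule.Quotient.mk q), h, map_zero]
  refine ⟨k l, ?_, ⟨?_⟩⟩
  · refine (pow_dvd_pow_iff Polynomial.X_ne_zero Polynomial.not_isUnit_X).mp
      ((hs0 (Polynomial.X ^ m)).mp ?_)
    rw [hs, hsmul, map_pow, hm, zero_smul]
  · let g : R →ₗ[R] N := LinearMap.toSpanSingleton R N (s (Submodule.Quotient.mk 1))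
    have hg : Function.Surjective g := by
      intro x
      obtain ⟨q, hq⟩ := Submodule.Quotient.mk_surjective _ (r x)
      exact ⟨f q, by rw [← hsr x, ← hq, hs q]; rfl⟩
    have hgk : LinearMap.ker g = Ideal.span {f Polynomial.X ^ k l} := by
      ext a
      obtain ⟨q, rfl⟩ := hf a
      have h1 : g (f q) = s (Submodule.Quotient.mk q) := (hs q).symm
      rw [LinearMap.mem_ker, h1, hs0, Ideal.mem_span_singleton']
      constructor
      · rintro ⟨c, rfl⟩
        exact ⟨f c, by rw [mul_comm, map_mul, map_pow]⟩
      · rintro ⟨b, hb⟩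
        obtain ⟨c, rfl⟩ := hf b
        rw [← hs0, ← h1, ← hb, ← map_pow, ← map_mul]
        have h2 : g (f (c * Polynomial.X ^ k l)) =
            s (Submodule.Quotient.mk (c * Polynomial.X ^ k l)) := (hs _).symm
        rw [h2, hs0]
        exact dvd_mul_left _ _
    exact ((Submodule.quotEquivOfEq _ _ hgk).symm.trans
      (g.quotKerEquivOfSurjective hg)).symm

theorem isFiniteRepType_of_surjective {K : Type w} [Field K] {A : Type u} [Ring A]
    (f : K[X] →+* Aᵐᵒᵖ) (hf : Function.Surjective f) (m : ℕ) (hm : f Polynomial.X ^ m = 0) :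
    IsFiniteRepType A := by
  -- The exponents run from 0 to `m`; the zero module at exponent 0 is harmless in the list.
  refine ⟨m + 1, fun k => ModuleCat.of Aᵐᵒᵖ (Aᵐᵒᵖ ⧸ Ideal.span {f Polynomial.X ^ (k : ℕ)}),
    fun N hN hN' => ?_⟩
  obtain ⟨k, hk, ⟨e⟩⟩ := hN'.nonempty_equiv_quotient_span_pow f hf m hm
  exact ⟨⟨k, Nat.lt_succ_of_le hk⟩, ⟨e⟩⟩

/-! ### Loops at a 1-vertex. -/

theorem IsRegularVertex.star_eq {V : Type u} [Quiver.{v} V] {i : V} (hi : IsRegularVertex 1 i)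
    (s t : Quiver.Star i) : s = t :=
  (Nat.card_eq_one_iff_unique.mp hi.2).1.elim s t

theorem IsRegularVertex.costar_eq {V : Type u} [Quiver.{v} V] {i : V} (hi : IsRegularVertex 1 i)
    (s t : Quiver.Costar i) : s = t :=
  (Nat.card_eq_one_iff_unique.mp hi.1).1.elim s t

/-- The loop uses up the only arrow into and the only arrow out of `i`, so no walk leaves `i`. -/
theorem IsRegularVertex.eq_of_loop {V : Type u} [Quiver.{v} V] (hconn : IsConnectedQuiver V)
    {i : V} (hi : IsRegularVertex 1 i) (γ : i ⟶ i) (a : V) : a = i := by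
  obtain ⟨p⟩ := (Quiver.WeaklyConnectedComponent.eq i a).mp (hconn.2 i a)
  induction p with
  | nil => rfl
  | @cons b c q α ih =>
    have ih' : b = i := ih
    subst ih'
    rcases α with α | α
    · exact congrArg Sigma.fst (hi.star_eq ⟨c, α⟩ ⟨b, γ⟩)
    · exact congrArg Sigma.fst (hi.costar_eq ⟨c, α⟩ ⟨b, γ⟩)

namespace PathAlgebra

variable {K : Type w} [Field K] {V : Type u} [Quiver.{v} V] [Fintype V]
  {I : Ideal (PathAlgebra K V)} [I.IsTwoSided]

theorem ofPath_toPath_pow {i : V} (hV : ∀ a : V, a = i) (γ : i ⟶ i)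
    (hγ : ∀ δ : i ⟶ i, δ = γ) {a b : V} (p : Quiver.Path a b) :
    (ofPath p : PathAlgebra K V) = ofPath γ.toPath ^ p.length := by
  induction p with
  | nil =>
    rw [Quiver.Path.length_nil, pow_zero, one_def, Finset.sum_eq_single a]
    · exact fun b _ hb => absurd ((hV b).trans (hV a).symm) hb
    · simp
  | @cons b c q δ ih =>
    obtain rfl := hV b
    obtain rfl := hV c
    rw [Quiver.Path.length_cons, pow_succ, ← ih, hγ δ, ofPath_mul_comp]
    rfl

/-- The quiver is a single loop, so the algebra is a quotient of `K[X]` in which, by admissibility,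
the image of `X` is nilpotent. -/
theorem isFiniteRepType_of_loop (hconn : IsConnectedQuiver V) (hI : IsAdmissible I) {i : V}
    (hi : IsRegularVertex 1 i) (γ : i ⟶ i) : IsFiniteRepType (PathAlgebra K V ⧸ I) := by
  have hV := hi.eq_of_loop hconn γ
  have hγ (δ : i ⟶ i) : δ = γ := by
    have := hi.star_eq ⟨i, δ⟩ ⟨i, γ⟩
    simpa using this
  have hpow {a b : V} (p : Quiver.Path a b) := ofPath_toPath_pow (K := K) hV γ hγ p
  set g : PathAlgebra K V := ofPath γ.toPath with hg
  let G : (PathAlgebra K V ⧸ I)ᵐᵒᵖ := MulOpposite.op (Ideal.Quotient.mk I g)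
  obtain ⟨m, hm, hmI⟩ := hI.2
  refine isFiniteRepType_of_surjective (Polynomial.aeval (R := K) G).toRingHom ?_ m ?_
  · suffices h : ∀ f : PathAlgebra K V, ∃ q : K[X],
        Polynomial.aeval G q = MulOpposite.op (Ideal.Quotient.mk I f) by
      intro a
      obtain ⟨f, hf⟩ := Ideal.Quotient.mk_surjective a.unop
      obtain ⟨q, hq⟩ := h f
      exact ⟨q, hq.trans (by rw [hf, MulOpposite.op_unop])⟩
    intro f
    induction f using induction_ofPath with
    | h0 => exact ⟨0, by rw [map_zero, map_zero, MulOpposite.op_zero]⟩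
    | hadd f₁ f₂ h₁ h₂ =>
      obtain ⟨q₁, h₁⟩ := h₁
      obtain ⟨q₂, h₂⟩ := h₂
      exact ⟨q₁ + q₂, by rw [map_add, map_add, MulOpposite.op_add, h₁, h₂]⟩
    | hsmul c a b p =>
      refine ⟨c • Polynomial.X ^ p.length, ?_⟩
      rw [map_smul, map_pow, Polynomial.aeval_X, hpow p]
      rfl
  · change Polynomial.aeval G Polynomial.X ^ m = 0
    obtain ⟨m, rfl⟩ : ∃ l, m = l + 1 := ⟨m - 1, by omega⟩
    have hR : g ∈ arrowIdeal K V := Submodule.subset_span ⟨i, i, γ.toPath, le_rfl, rfl⟩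
    have h : g ^ (m + 1) ∈ arrowIdeal K V ^ (m + 1) := Submodule.pow_mem_pow _ hR _
    rw [Polynomial.aeval_X, ← MulOpposite.op_pow, ← map_pow,
      Ideal.Quotient.eq_zero_iff_mem.mpr (hmI h), MulOpposite.op_zero]

end PathAlgebra

/-! ### Counting arrows and the triangle argument. -/

theorem Quiver.card_star {V : Type u} [Fintype V] [Quiver.{v} V] [∀ a b : V, Finite (a ⟶ b)]
    (a : V) : Nat.card (Quiver.Star a) = ∑ c, Nat.card (a ⟶ c) :=
  Nat.card_sigma

theorem Quiver.card_costar {V : Type u} [Fintype V] [Quiver.{v} V] [∀ a b : V, Finite (a ⟶ b)]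
    (a : V) : Nat.card (Quiver.Costar a) = ∑ c, Nat.card (c ⟶ a) :=
  Nat.card_sigma

theorem Finset.sum_mul_eq_of_sum_eq_one {ι : Type*} [Fintype ι] {n : ι → ℕ} (h : ∑ c, n c = 1)
    {k : ι} (hk : 1 ≤ n k) (p : ι → ℕ) : ∑ c, n c * p c = p k := by
  classical
  rw [← Finset.add_sum_erase _ _ (Finset.mem_univ k)] at h ⊢
  have h0 : ∑ c ∈ Finset.univ.erase k, n c = 0 := by omega
  rw [Finset.sum_eq_zero fun c hc => by rw [Finset.sum_eq_zero_iff.mp h0 c hc, zero_mul],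
    show n k = 1 by omega, one_mul, add_zero]

theorem Finset.le_sum_mul {ι : Type*} [Fintype ι] {n : ι → ℕ} {k : ι} (hk : 1 ≤ n k)
    (p : ι → ℕ) : p k ≤ ∑ c, n c * p c :=
  (Nat.le_mul_of_pos_left _ hk).trans
    (Finset.single_le_sum (f := fun c => n c * p c) (fun _ _ => Nat.zero_le _) (Finset.mem_univ k))

/-- In a triangle `x → i → j → x` whose vertex `i` is a `1`-vertex without loop, the numerical
constraints imposed by periodicity of period four force at least two arrows to start and to end at
both `x` and `j`. Here `n` counts arrows and `p` is the Cartan matrix. -/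
theorem two_le_degree_of_triangle {V : Type*} [Fintype V] [DecidableEq V] (n p : V → V → ℕ)
    (hsymm : ∀ a d, ∑ c, n c a * p c d = ∑ c, n a c * p c d)
    (hle : ∀ a d, p a d + n a d ≤ ∑ c, n c a * p c d + if a = d then 1 else 0)
    {x i j : V} (hγ : 1 ≤ n x i) (hα : 1 ≤ n i j) (hβ : 1 ≤ n j x)
    (hin : ∑ c, n c i = 1) (hout : ∑ c, n i c = 1) (hxi : x ≠ i) (hij : i ≠ j) :
    (2 ≤ ∑ c, n c x ∧ 2 ≤ ∑ c, n x c) ∧ 2 ≤ ∑ c, n c j ∧ 2 ≤ ∑ c, n j c := by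
  have hpos {m : V → ℕ} {k : V} (hk : 1 ≤ m k) : 1 ≤ ∑ c, m c :=
    hk.trans (Finset.single_le_sum (f := m) (fun _ _ => Nat.zero_le _) (Finset.mem_univ k))
  -- The equality at `i`, where `x` is the only predecessor and `j` the only successor.
  have hxj (d : V) : p x d = p j d := by
    rw [← Finset.sum_mul_eq_of_sum_eq_one hin hγ fun c => p c d,
      ← Finset.sum_mul_eq_of_sum_eq_one hout hα fun c => p c d, hsymm]
  have hlt : p i j + 1 ≤ p x j := by
    have h := hle i j
    rw [Finset.sum_mul_eq_of_sum_eq_one hin hγ fun c => p c j, if_neg hij] at h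
    omega
  refine ⟨⟨?_, ?_⟩, ?_, ?_⟩ <;> by_contra! hcon
  -- If `j` is the only predecessor of `x`, the inequality at (x, i) reads p x i + n x i ≤ p j i = p
  -- x i.
  · have h1 : ∑ c, n c x = 1 := by have := hpos hβ (m := fun c => n c x); omega
    have h := hle x i
    rw [Finset.sum_mul_eq_of_sum_eq_one h1 hβ fun c => p c i, if_neg hxi, hxj] at h
    omega
  -- If `i` is the only successor of `x`, the equality at `x` gives p j j ≤ p i j < p x j = p j j.
  · have h1 : ∑ c, n x c = 1 := by have := hpos hγ (m := fun c => n x c); omega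
    have h := Finset.le_sum_mul (n := fun c => n c x) hβ fun c => p c j
    rw [hsymm, Finset.sum_mul_eq_of_sum_eq_one h1 hγ fun c => p c j] at h
    have := hxj j
    omega
  -- If `i` is the only predecessor of `j`, the equality at `j` gives p x j ≤ p i j < p x j.
  · have h1 : ∑ c, n c j = 1 := by have := hpos hα (m := fun c => n c j); omega
    have h := Finset.le_sum_mul (n := fun c => n j c) hβ fun c => p c j
    rw [← hsymm, Finset.sum_mul_eq_of_sum_eq_one h1 hα fun c => p c j] at h
    omega
  -- If `x` is the only successor of `j`, the inequality at (j, x) reads p j x + n j x ≤ p x x = p j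
  -- x when j ≠ x. When j = x the Kronecker term spoils this, but then `j` has both a loop and an
  -- arrow to `i`.
  · have h1 : ∑ c, n j c = 1 := by have := hpos hβ (m := fun c => n j c); omega
    have h := hle j x
    rw [hsymm, Finset.sum_mul_eq_of_sum_eq_one h1 hβ fun c => p c x] at h
    have hx := hxj x
    split_ifs at h with hjx
    · subst hjx
      have h2 : n j i ≤ ∑ c ∈ Finset.univ.erase j, n j c :=
        Finset.single_le_sum (f := n j) (fun _ _ => Nat.zero_le _)
          (Finset.mem_erase.mpr ⟨hxi.symm, Finset.mem_univ i⟩)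
      rw [← Finset.add_sum_erase _ _ (Finset.mem_univ j)] at h1
      omega
    · omega

theorem lemma4p4 {K : Type w} [Field K] [IsAlgClosed K]
    {V : Type u} [Fintype V] [Quiver.{v} V] [∀ a b : V, Finite (a ⟶ b)]
    (hconn : IsConnectedQuiver V) (hbis : IsBiserialQuiver V)
    (I : Ideal (PathAlgebra K V)) [I.IsTwoSided] (hI : PathAlgebra.IsAdmissible I)
    (hA : IsTSP4 K (PathAlgebra K V ⧸ I))
    (hinf : ¬ IsFiniteRepType (PathAlgebra K V ⧸ I))
    {x i j : V} (γ : x ⟶ i) (α : i ⟶ j) (β : j ⟶ x) (hi : IsRegularVertex 1 i) :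
    IsRegularVertex 2 x ∧ IsRegularVertex 2 j := by
  classical
  have hloop (δ : i ⟶ i) : False := hinf (PathAlgebra.isFiniteRepType_of_loop hconn hI hi δ)
  have hxi : x ≠ i := by rintro rfl; exact hloop γ
  have hij : i ≠ j := by rintro rfl; exact hloop α
  have : FiniteDimensional K (PathAlgebra K V ⧸ I) := hI.finiteDimensional
  have hcard {a b : V} (δ : a ⟶ b) : 1 ≤ Nat.card (a ⟶ b) :=
    haveI : Nonempty (a ⟶ b) := ⟨δ⟩
    Nat.card_pos
  have hcartan := hI.idempotents.cartan_of_isPeriodicAlgebra hI.rad_le_jacobson hA.symmetric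
    hA.periodic
  simp only [hI.finrank_radForms] at hcartan
  have h := two_le_degree_of_triangle (fun a b : V => Nat.card (a ⟶ b)) _
    (fun a d => (hcartan a d).1) (fun a d => (hcartan a d).2) (hcard γ) (hcard α) (hcard β)
    ((Quiver.card_costar i).symm.trans hi.1) ((Quiver.card_star i).symm.trans hi.2) hxi hij
  simp only [← Quiver.card_star, ← Quiver.card_costar] at h
  exact ⟨⟨(hbis x).1.antisymm h.1.1, (hbis x).2.antisymm h.1.2⟩,
    (hbis j).1.antisymm h.2.1, (hbis j).2.antisymm h.2.2⟩
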